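/- Consider the Sherrington--Kirkpatrick model with $N$ spins $\sigma\in\{-1,+1\}^N$ at inverse temperature $\beta$ in a Gaussian random external field of variance $x\ge 0$: for independent standard Gaussians $J_{ij}$ ($1\le i<j\le N$) and $J_i$ ($1\le i\le N$), each configuration $\sigma$ has Gibbs weight proportional to $$\exp\Big(\frac{\beta}{\sqrt N}\sum_{i<j}J_{ij}\sigma_i\sigma_j+\sqrt{x}\,\sum_{i}J_i\sigma_i\Big).$$ Let $\langle\cdot\rangle_{x}=\langle\cdot\rangle_{N,x}$ be the average over replicas $\sigma^{(1)},\sigma^{(2)},\dots$ (independent draws from this Gibbs measure with the same disorder), followed by the expectation over the disorder, write $\langle\cdot\rangle=\langle\cdot\rangle_{0}$, and let $q_{ab}=\frac1N\sum_i\sigma^{(a)}_i\sigma^{(b)}_i$ be the overlaps. Let $\beta>\beta_c$, where $\beta_c=1$ is the critical inverse temperature. Then: (i) There is $y_0>0$ such that for all $y$ with $0<|y|<y_0$, setting $x=y^2/N$, the average overlap stays strictly positive as $N\to\infty$: $$\liminf_{N\to\infty}\langle q_{12}\rangle_{x=y^2/N}>0 ,$$ and the limit $\lim_{N\to\infty}\langle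 q_{12}\rangle_{x=y^2/N}$ exists and is strictly positive whenever the zero-field model has a thermodynamic limit, i.e. whenever the averages $\langle\cdot\rangle_{N,0}$ of all monomials in the overlaps of finitely many replicas converge as $N\to\infty$. More generally, for the same $y_0$, the limit exists and is strictly positive along every sequence of sizes $N_1<N_2<\cdots$ along which these zero-field averages converge. (ii) In contrast, $\langle q_{12}\rangle_{x=0}=0$ for every $N$, and $\lim_{x\to0^+}\langle q_{12}\rangle_{x}=0$ for every fixed $N$; so the result of letting $x\to0^+$ and $N\to\infty$ depends on the way in which it is done. (iii) There is a constant $C$, independent of $N$ and $y$, such that for all $N$ and all real $y$ $$\Big|\langle q_{12}\rangle_{x=y^2/N}-\langle q_{12}^2\rangle\,y^2+2\,\langle q_{12}q_{23}q_{13}\rangle\,y^4\Big|\le C\,y^6 .$$ -/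

import Mathlib

open MeasureTheory ProbabilityTheory Filter Topology

noncomputable section

namespace SK

/-- Spin configurations `σ : {1,…,N} → {-1,+1}`. -/
abbrev Config (N : ℕ) : Type := Fin N → ℤˣ

/-- The real value `±1` of the spin at site `i`. -/
def spin {N : ℕ} (σ : Config N) (i : Fin N) : ℝ := ((σ i : ℤ) : ℝ)

/-- The `N(N-1)/2` couples of distinct sites. -/
abbrev Couple (N : ℕ) : Type := {p : Fin N × Fin N // p.1 < p.2}

/-- The quenched variables: the couplings `J_{ij}` and the external fields `J_i`. -/
abbrev Disorder (N : ℕ) : Type := (Couple N → ℝ) × (Fin N → ℝ)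

/-- All the quenched variables are independent centered unit Gaussians. -/
def disorderLaw (N : ℕ) : Measure (Disorder N) :=
  (Measure.pi fun _ : Couple N => gaussianReal 0 1).prod
    (Measure.pi fun _ : Fin N => gaussianReal 0 1)

/-- The Sherrington-Kirkpatrick Hamiltonian. -/
def hamiltonian {N : ℕ} (J : Couple N → ℝ) (σ : Config N) : ℝ :=
  (-1 / √(N : ℝ)) * ∑ p : Couple N, J p * spin σ p.1.1 * spin σ p.1.2

/-- The Boltzmann factor at inverse temperature `β`, with a random external field of
variance `x`. -/
def boltzmann {N : ℕ} (β x : ℝ) (ω : Disorder N) (σ : Config N) : ℝ :=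
  Real.exp (-β * hamiltonian ω.1 σ + √x * ∑ i, ω.2 i * spin σ i)

/-- The partition function. -/
def partition {N : ℕ} (β x : ℝ) (ω : Disorder N) : ℝ :=
  ∑ σ : Config N, boltzmann β x ω σ

/-- The Gibbs weight of a configuration. -/
def gibbs {N : ℕ} (β x : ℝ) (ω : Disorder N) (σ : Config N) : ℝ :=
  boltzmann β x ω σ / partition β x ω

/-- The expectation of `A` under the replica measure, that is the product of `n` copies of
the Gibbs measure with the same disorder. -/
def replicaExp {N n : ℕ} (β x : ℝ) (ω : Disorder N) (A : (Fin n → Config N) → ℝ) : ℝ :=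
  ∑ τ : Fin n → Config N, A τ * ∏ a, gibbs β x ω (τ a)

/-- The global average `⟨A⟩_x` at system size `N`: the replica measure first, the disorder
afterwards. -/
def average (N : ℕ) {n : ℕ} (β x : ℝ) (A : (Fin n → Config N) → ℝ) : ℝ :=
  ∫ ω, replicaExp β x ω A ∂(disorderLaw N)

/-- The overlap `q_{ab}` of the replicas `a` and `b`. -/
def q {N n : ℕ} (a b : Fin n) (τ : Fin n → Config N) : ℝ :=
  (1 / (N : ℝ)) * ∑ i, spin (τ a) i * spin (τ b) i

/-- The critical inverse temperature `β_c = 1` of the model in this normalization. -/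
def criticalBeta : ℝ := 1

/-- The zero-field model has a thermodynamic limit along the sizes `φ 0, φ 1, …`: the
averages, without external field, of all monomials in the overlaps of finitely many replicas
converge. -/
def HasThermodynamicLimit (β : ℝ) (φ : ℕ → ℕ) : Prop :=
  ∀ (n : ℕ) (k : Fin n → Fin n → ℕ), ∃ l : ℝ,
    Tendsto (fun j : ℕ => average (φ j) β 0
      (fun τ : Fin n → Config (φ j) => ∏ a, ∏ b, q a b τ ^ k a b)) atTop (𝓝 l)

end SK

end

set_option linter.unusedSectionVars false

noncomputable section

namespace SK

/-! Expansion in the field. Differentiating a disorder-averaged replica average with respect to the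
field, and integrating by parts over the Gaussian fields, gives an average of the same kind with two
more replicas. With field variance `y ^ 2 / N`, the derivative in the variable `y ^ 2` replaces `f`
by `lap f` (`hasDerivAt_fieldAvg`). The factor `1 / N` compensates the sum over sites, so `lap` is
bounded uniformly in `N`, and Taylor's formula to third order in `y ^ 2` has a uniform remainder. At
zero field the spin-flip symmetry of each replica removes every term of the coefficients except the
square of an overlap and the triangle (`gavg_lap_q`, `gavg_lap_lap_q`).

Positivity. For small `y` the quadratic term dominates as soon as the zero-field mean square overlap
stays away from zero for `β > 1`; this is `exists_le_meanSq`, proved by contradiction. The pressure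
is convex in `β`, and integration by parts expresses its slope through `meanSq`
(`pressure_tangent`). If `meanSq` were small for infinitely many sizes at `β₀`, convexity and the
existence of the limiting pressure would make it small for all large sizes at a slightly larger `β`.
Adding one spin is the same as switching on a field of variance `β ^ 2 / N` (`pressure_succ`), whose
effect on the pressure is almost the annealed one when `meanSq` is small (`fieldPressure_ge`). The
increments of the pressure would then be almost annealed, which contradicts the strict gap that
Guerra's replica-symmetric bound gives for `β > 1` (`exists_pressure_gap`).

Existence of the limit. The pressure gained from the field is the mean logarithm of the Gibbs
average of `cosh` of the field energy. Replacing the Gibbs average by an empirical average over `n`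
replicas costs `O(1 / √n)` uniformly in `N` (`abs_fieldPressure_sub_empPressure_le`). Once the
fields are integrated out, the result is a Lipschitz function of the overlaps, so its average
converges by Stone-Weierstrass (`cauchySeq_empPressure`). The average overlap is read off from the
`y`-derivative of the field pressure, and converges because the second derivative is bounded
uniformly in `N` (`cauchySeq_fieldAvg`). -/

/-- The standard Gaussian measure on a finite product. -/
def stdGauss (I : Type*) [Fintype I] : Measure (I → ℝ) :=
  Measure.pi fun _ => gaussianReal 0 1

instance {I : Type*} [Fintype I] : IsProbabilityMeasure (stdGauss I) := by
  unfold stdGauss; infer_instance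

/-! ### Gaussian integration by parts. -/

lemma hasDerivAt_gaussianPDFReal (x : ℝ) :
    HasDerivAt (gaussianPDFReal 0 1) (-x * gaussianPDFReal 0 1 x) x := by
  have h : gaussianPDFReal 0 1 = fun x => (√(2 * Real.pi))⁻¹ * Real.exp (-x ^ 2 / 2) := by
    ext x; simp [gaussianPDFReal]
  rw [h]
  have h1 : HasDerivAt (fun x : ℝ => -x ^ 2 / 2) (-x) x := by
    have := ((hasDerivAt_pow 2 x).neg).div_const 2
    convert! this using 1
    push_cast; ring
  convert! (h1.exp.const_mul ((√(2 * Real.pi))⁻¹)) using 1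
  ring

lemma integrable_id_gaussianReal : Integrable (fun x : ℝ => x) (gaussianReal 0 1) := by
  have := (memLp_id_gaussianReal (μ := 0) (v := 1) 1)
  exact memLp_one_iff_integrable.1 (by exact_mod_cast this)

lemma integrable_bounded_continuous {X : Type*} [TopologicalSpace X] [MeasurableSpace X]
    [BorelSpace X] {μ : Measure X} [IsFiniteMeasure μ] {f : X → ℝ} (hf : Continuous f)
    [SecondCountableTopology X]
    {A : ℝ} (hA : ∀ x, |f x| ≤ A) : Integrable f μ :=
  Integrable.of_bound hf.aestronglyMeasurable A (ae_of_all _ hA)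

lemma integrable_gaussian_iff {f : ℝ → ℝ} :
    Integrable f (gaussianReal 0 1) ↔ Integrable (fun x => f x * gaussianPDFReal 0 1 x) := by
  rw [gaussianReal_of_var_ne_zero 0 one_ne_zero,
    integrable_withDensity_iff (measurable_gaussianPDF 0 1) (by simp [gaussianPDF])]
  simp [toReal_gaussianPDF]

lemma gaussian_ibp {f f' : ℝ → ℝ} (hf : ∀ x, HasDerivAt f (f' x) x) (hc : Continuous f')
    {A B : ℝ} (hA : ∀ x, |f x| ≤ A) (hB : ∀ x, |f' x| ≤ B) :
    ∫ x, x * f x ∂gaussianReal 0 1 = ∫ x, f' x ∂gaussianReal 0 1 := by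
  have hfc : Continuous f := continuous_iff_continuousAt.2 fun x => (hf x).continuousAt
  have h1 : Integrable (fun x => x * f x) (gaussianReal 0 1) :=
    (integrable_id_gaussianReal.bdd_mul (c := A) hfc.aestronglyMeasurable
      (ae_of_all _ hA)).congr (ae_of_all _ fun _ => mul_comm _ _)
  have h2 : Integrable f' (gaussianReal 0 1) := integrable_bounded_continuous hc hB
  have h3 : Integrable f (gaussianReal 0 1) := integrable_bounded_continuous hfc hA
  rw [integrable_gaussian_iff] at h1 h2 h3
  have key := integral_mul_deriv_eq_deriv_mul_of_integrable (u := f) (u' := f')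
    (v := gaussianPDFReal 0 1) (v' := fun x => -x * gaussianPDFReal 0 1 x) (fun x _ => hf x)
    (fun x _ => hasDerivAt_gaussianPDFReal x) ?_ ?_ ?_
  · rw [integral_gaussianReal_eq_integral_smul one_ne_zero,
      integral_gaussianReal_eq_integral_smul one_ne_zero]
    simp only [smul_eq_mul]
    have e1 : ∫ x, gaussianPDFReal 0 1 x * (x * f x) =
        -∫ x, f x * (-x * gaussianPDFReal 0 1 x) := by
      rw [← integral_neg]; congr 1; ext x; ring
    rw [e1, key, neg_neg]
    congr 1; ext x; ring
  · exact h1.neg.congr (ae_of_all _ fun x => by simp; ring)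
  · exact h2
  · exact h3

section Pi

variable {I : Type*} [Fintype I]

lemma integrable_coord (k : I) : Integrable (fun ω : I → ℝ => ω k) (stdGauss I) := by
  have := measurePreserving_eval (fun _ : I => gaussianReal 0 1) k
  exact (this.integrable_comp integrable_id_gaussianReal.1).2 integrable_id_gaussianReal

lemma integrable_coord_mul (k : I) {h : (I → ℝ) → ℝ} (hc : Continuous h) {A : ℝ}
    (hA : ∀ ω, |h ω| ≤ A) : Integrable (fun ω : I → ℝ => ω k * h ω) (stdGauss I) :=
  ((integrable_coord k).bdd_mul (c := A) hc.aestronglyMeasurable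
      (ae_of_all _ hA)).congr (ae_of_all _ fun _ => mul_comm _ _)

variable [DecidableEq I]

/-- Resampling one coordinate independently does not change a product law. This reduces integration
by parts in one coordinate to the real line. -/
lemma measurePreserving_update (k : I) :
    MeasurePreserving (fun p : (I → ℝ) × ℝ => Function.update p.1 k p.2)
      ((stdGauss I).prod (gaussianReal 0 1)) (stdGauss I) := by
  have hm : Measurable (fun p : (I → ℝ) × ℝ => Function.update p.1 k p.2) := by
    rw [measurable_pi_iff]
    intro i
    by_cases h : i = k
    · subst h; simpa using measurable_snd
    · simp only [Function.update_of_ne h]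
      exact (measurable_pi_apply i).comp measurable_fst
  refine ⟨hm, ?_⟩
  refine (Measure.pi_eq fun s hs => ?_).symm
  rw [Measure.map_apply hm (MeasurableSet.univ_pi hs)]
  have : (fun p : (I → ℝ) × ℝ => Function.update p.1 k p.2) ⁻¹' (Set.univ.pi s) =
      (Set.univ.pi (Function.update s k Set.univ)) ×ˢ (s k) := by
    ext p
    simp only [Set.mem_preimage, Set.mem_pi, Set.mem_univ, true_imp_iff, Set.mem_prod]
    constructor
    · intro h
      refine ⟨fun i => ?_, by simpa using h k⟩
      by_cases hi : i = k
      · subst hi; simp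
      · have := h i
        simpa [Function.update_of_ne hi] using this
    · rintro ⟨h, h2⟩ i
      by_cases hi : i = k
      · subst hi; simpa using h2
      · have := h i
        simpa [Function.update_of_ne hi] using this
  rw [this, Measure.prod_prod, stdGauss, Measure.pi_pi,
    ← Finset.mul_prod_erase _ _ (Finset.mem_univ k),
    ← Finset.mul_prod_erase (Finset.univ) (fun i => (gaussianReal 0 1) (s i)) (Finset.mem_univ k)]
  simp only [Function.update_self, measure_univ, one_mul]
  rw [mul_comm]
  congr 1
  refine Finset.prod_congr rfl fun i hi => ?_
  rw [Function.update_of_ne (Finset.ne_of_mem_erase hi)]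

lemma integral_update (k : I) {h : (I → ℝ) → ℝ} (hi : Integrable h (stdGauss I)) :
    ∫ ω, h ω ∂stdGauss I =
      ∫ ω, ∫ t, h (Function.update ω k t) ∂gaussianReal 0 1 ∂stdGauss I := by
  have mp := measurePreserving_update (I := I) k
  rw [← mp.map_eq] at hi
  have h2 := (integrable_map_measure hi.1 mp.measurable.aemeasurable).1 hi
  rw [← integral_prod (f := fun p : (I → ℝ) × ℝ => h (Function.update p.1 k p.2)) h2]
  conv_lhs => rw [← mp.map_eq]
  rw [integral_map mp.measurable.aemeasurable hi.1]

/-- Gaussian integration by parts in one coordinate. -/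
lemma stdGauss_ibp (k : I) {h h' : (I → ℝ) → ℝ}
    (hd : ∀ ω t, HasDerivAt (fun t => h (Function.update ω k t)) (h' (Function.update ω k t)) t)
    (hc : Continuous h) (hc' : Continuous h')
    {A B : ℝ} (hA : ∀ x, |h x| ≤ A) (hB : ∀ x, |h' x| ≤ B) :
    ∫ ω, ω k * h ω ∂stdGauss I = ∫ ω, h' ω ∂stdGauss I := by
  rw [integral_update k (integrable_coord_mul k hc hA),
    integral_update k (integrable_bounded_continuous hc' hB)]
  congr 1; ext ω
  simp only [Function.update_self]
  refine gaussian_ibp (hd ω) (hc'.comp ?_) (fun x => hA _) (fun x => hB _)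
  exact continuous_const.update k continuous_id

end Pi

/-! ### Gibbs weights and replica averages. -/

section Gibbs

variable {S : Type*} [Fintype S]

/-- The Gibbs weight attached to a vector of exponents. -/
def gw (E : S → ℝ) (s : S) : ℝ := Real.exp (E s) / ∑ s', Real.exp (E s')

/-- The average over `n` independent replicas. -/
def rep {n : ℕ} (E : S → ℝ) (f : (Fin n → S) → ℝ) : ℝ := ∑ τ, f τ * ∏ a, gw E (τ a)

/-- The fluctuation of `φ`, with respect to a new replica, inserted into `f`. -/
def conn {n : ℕ} (φ : S → ℝ) (f : (Fin n → S) → ℝ) (τ : Fin (n + 1) → S) : ℝ :=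
  f (Fin.init τ) * (∑ a : Fin n, φ (τ a.castSucc) - n * φ (τ (Fin.last n)))

lemma gw_nonneg (E : S → ℝ) (s : S) : 0 ≤ gw E s := by
  unfold gw; positivity

lemma rep_add {n : ℕ} (E : S → ℝ) (f g : (Fin n → S) → ℝ) :
    rep E (fun τ => f τ + g τ) = rep E f + rep E g := by
  simp [rep, add_mul, Finset.sum_add_distrib]

lemma rep_sub {n : ℕ} (E : S → ℝ) (f g : (Fin n → S) → ℝ) :
    rep E (fun τ => f τ - g τ) = rep E f - rep E g := by
  simp [rep, sub_mul, Finset.sum_sub_distrib]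

lemma rep_mul_left {n : ℕ} (E : S → ℝ) (c : ℝ) (f : (Fin n → S) → ℝ) :
    rep E (fun τ => c * f τ) = c * rep E f := by
  simp [rep, mul_assoc, Finset.mul_sum]

lemma rep_sum {n : ℕ} {κ : Type*} (t : Finset κ) (E : S → ℝ) (f : κ → (Fin n → S) → ℝ) :
    rep E (fun τ => ∑ k ∈ t, f k τ) = ∑ k ∈ t, rep E (f k) := by
  simp only [rep, Finset.sum_mul]
  rw [Finset.sum_comm]

lemma rep_mono {n : ℕ} (E : S → ℝ) {f g : (Fin n → S) → ℝ} (h : ∀ τ, f τ ≤ g τ) :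
    rep E f ≤ rep E g :=
  Finset.sum_le_sum fun τ _ =>
    mul_le_mul_of_nonneg_right (h τ) (Finset.prod_nonneg fun _ _ => gw_nonneg _ _)

lemma conn_sum {n : ℕ} {κ : Type*} (t : Finset κ) (φ : κ → S → ℝ) (f : (Fin n → S) → ℝ)
    (τ : Fin (n + 1) → S) :
    conn (fun s => ∑ k ∈ t, φ k s) f τ = ∑ k ∈ t, conn (φ k) f τ := by
  simp only [conn]
  rw [← Finset.mul_sum, Finset.sum_sub_distrib, Finset.sum_comm, Finset.mul_sum]

lemma conn_mul {n : ℕ} (c : ℝ) (φ : S → ℝ) (f : (Fin n → S) → ℝ) (τ : Fin (n + 1) → S) :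
    conn (fun s => c * φ s) f τ = c * conn φ f τ := by
  simp only [conn, ← Finset.mul_sum]; ring

lemma rep_succ {n : ℕ} (E : S → ℝ) (f : (Fin (n + 1) → S) → ℝ) :
    rep E f = rep E fun τ : Fin n → S => ∑ s, f (Fin.snoc τ s) * gw E s := by
  simp only [rep]
  rw [← (Fin.snocEquiv fun _ : Fin (n + 1) => S).sum_comp, Fintype.sum_prod_type_right]
  refine Finset.sum_congr rfl fun τ _ => ?_
  rw [Finset.sum_mul]
  refine Finset.sum_congr rfl fun s _ => ?_
  rw [Fin.prod_univ_castSucc]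
  simp [Fin.snocEquiv]
  ring

variable [Nonempty S]

lemma sum_exp_pos (E : S → ℝ) : 0 < ∑ s, Real.exp (E s) :=
  Finset.sum_pos (fun _ _ => Real.exp_pos _) Finset.univ_nonempty

lemma sum_gw (E : S → ℝ) : ∑ s, gw E s = 1 := by
  simp only [gw, ← Finset.sum_div]
  exact div_self (sum_exp_pos E).ne'

lemma gw_le_one (E : S → ℝ) (s : S) : gw E s ≤ 1 := by
  rw [← sum_gw E]
  exact Finset.single_le_sum (fun s _ => gw_nonneg E s) (Finset.mem_univ s)

lemma rep_const {n : ℕ} (E : S → ℝ) (c : ℝ) : rep E (fun _ : Fin n → S => c) = c := by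
  classical
  have := Finset.prod_univ_sum (fun _ : Fin n => (Finset.univ : Finset S)) (fun _ s => gw E s)
  simp only [sum_gw, Finset.prod_const_one, Fintype.piFinset_univ] at this
  rw [rep, ← Finset.mul_sum, ← this, mul_one]

lemma rep_prod {n : ℕ} (E : S → ℝ) (φ : Fin n → S → ℝ) :
    rep E (fun τ : Fin n → S => ∏ a, φ a (τ a)) = ∏ a, ∑ s, φ a s * gw E s := by
  classical
  have := Finset.prod_univ_sum (fun _ : Fin n => (Finset.univ : Finset S))
    (fun a s => φ a s * gw E s)
  simp only [Fintype.piFinset_univ] at this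
  rw [rep, this]
  simp [Finset.prod_mul_distrib]

lemma abs_rep_le {n : ℕ} (E : S → ℝ) {f : (Fin n → S) → ℝ} {A : ℝ} (h : ∀ τ, |f τ| ≤ A) :
    |rep E f| ≤ A := by
  rw [abs_le]
  constructor
  · rw [← rep_const (n := n) E (-A)]
    exact rep_mono E fun τ => (abs_le.1 (h τ)).1
  · rw [← rep_const (n := n) E A]
    exact rep_mono E fun τ => (abs_le.1 (h τ)).2

lemma rep_init {n : ℕ} (E : S → ℝ) (f : (Fin n → S) → ℝ) :
    rep E (fun τ : Fin (n + 1) → S => f (Fin.init τ)) = rep E f := by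
  rw [rep_succ]
  simp [← Finset.mul_sum, sum_gw]

lemma rep_conn {n : ℕ} (E φ : S → ℝ) (f : (Fin n → S) → ℝ) :
    rep E (conn φ f) = rep E (fun τ => f τ * ∑ a, φ (τ a)) -
      n * (∑ s, φ s * gw E s) * rep E f := by
  rw [rep_succ, ← rep_mul_left, ← rep_sub]
  congr 1; ext τ
  simp only [conn, Fin.init_snoc, Fin.snoc_castSucc, Fin.snoc_last]
  simp only [mul_sub, sub_mul, Finset.sum_sub_distrib]
  rw [← Finset.mul_sum, sum_gw, mul_one, Finset.mul_sum]
  congr 1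
  rw [Finset.mul_sum, Finset.sum_mul]
  refine Finset.sum_congr rfl fun s _ => ?_
  ring

lemma rep_eq_div {n : ℕ} (E : S → ℝ) (f : (Fin n → S) → ℝ) :
    rep E f = (∑ τ : Fin n → S, f τ * Real.exp (∑ a, E (τ a))) / (∑ s, Real.exp (E s)) ^ n := by
  simp only [rep, gw, Finset.prod_div_distrib, Finset.prod_const, Finset.card_univ,
    Fintype.card_fin, Real.exp_sum, Finset.sum_div, mul_div_assoc]

/-- Each replica contributes its own `E'`, and the `n` partition functions in the denominator
subtract `n` times the mean of `E'`. Writing that mean with a fresh replica produces `conn`. -/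
lemma hasDerivAt_rep {n : ℕ} (f : (Fin n → S) → ℝ) {E : ℝ → S → ℝ} {E' : S → ℝ} {t : ℝ}
    (h : ∀ s, HasDerivAt (fun t => E t s) (E' s) t) :
    HasDerivAt (fun t => rep (E t) f) (rep (E t) (conn E' f)) t := by
  have hZ : HasDerivAt (fun t => ∑ s, Real.exp (E t s)) (∑ s, Real.exp (E t s) * E' s) t :=
    HasDerivAt.fun_sum fun s _ => (h s).exp
  have hN : HasDerivAt (fun t => ∑ τ : Fin n → S, f τ * Real.exp (∑ a, E t (τ a)))
      (∑ τ : Fin n → S, f τ * (Real.exp (∑ a, E t (τ a)) * ∑ a, E' (τ a))) t :=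
    HasDerivAt.fun_sum fun τ _ => ((HasDerivAt.fun_sum fun a _ => h (τ a)).exp).const_mul _
  have hq := hN.div (hZ.pow n) (pow_ne_zero n (sum_exp_pos (E t)).ne')
  have e : (fun t => rep (E t) f) = fun t => (∑ τ : Fin n → S, f τ * Real.exp (∑ a, E t (τ a))) /
      (∑ s, Real.exp (E t s)) ^ n := by ext t; exact rep_eq_div _ _
  rw [e]
  convert! hq using 1
  rw [rep_conn, rep_eq_div, rep_eq_div]
  have hz := (sum_exp_pos (E t)).ne'
  have e1 : ∑ s, E' s * gw (E t) s = (∑ s, Real.exp (E t s) * E' s) / ∑ s, Real.exp (E t s) := by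
    rw [Finset.sum_div]
    refine Finset.sum_congr rfl fun s _ => ?_
    rw [gw]; ring
  have e2 : ∑ τ : Fin n → S, f τ * (∑ a, E' (τ a)) * Real.exp (∑ a, E t (τ a)) =
      ∑ τ : Fin n → S, f τ * (Real.exp (∑ a, E t (τ a)) * ∑ a, E' (τ a)) :=
    Finset.sum_congr rfl fun τ _ => by ring
  rw [e1, e2]
  simp only [Pi.pow_apply]
  rcases n with _ | n
  · simp
  · simp only [Nat.add_sub_cancel]
    generalize (∑ s, Real.exp (E t s)) = Z at *
    field_simp
    ring

lemma continuous_rep {n : ℕ} (f : (Fin n → S) → ℝ) : Continuous fun E : S → ℝ => rep E f := by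
  unfold rep gw
  refine continuous_finsetSum _ fun τ _ => continuous_const.mul
    (continuous_finsetProd _ fun a _ => Continuous.div (by fun_prop) (by fun_prop)
      fun E => (sum_exp_pos E).ne')

lemma hasDerivAt_log_sum_exp {E : ℝ → S → ℝ} {E' : S → ℝ} {t : ℝ}
    (h : ∀ s, HasDerivAt (fun t => E t s) (E' s) t) :
    HasDerivAt (fun t => Real.log (∑ s, Real.exp (E t s)))
      (rep (E t) fun τ : Fin 1 → S => E' (τ 0)) t := by
  have hZ : HasDerivAt (fun t => ∑ s, Real.exp (E t s)) (∑ s, Real.exp (E t s) * E' s) t :=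
    HasDerivAt.fun_sum fun s _ => (h s).exp
  convert! hZ.log (sum_exp_pos (E t)).ne' using 1
  have := rep_prod (E t) (fun _ : Fin 1 => E')
  simp only [Fin.prod_univ_one, Fin.isValue] at this
  rw [this, Finset.sum_div]
  refine Finset.sum_congr rfl fun s _ => ?_
  rw [gw]; ring

end Gibbs

/-! ### Gibbs measures with Gaussian exponents. -/

section Gaussian

variable {S I J : Type*} [Fintype S] [Fintype I] [Fintype J]

/-- The Gaussian exponents with coefficients `v`. -/
def energy (v : I → S → ℝ) (ω : I → ℝ) (s : S) : ℝ := ∑ i, ω i * v i s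

/-- The average over the replicas, then over the Gaussian disorder. -/
def gavg {n : ℕ} (v : I → S → ℝ) (f : (Fin n → S) → ℝ) : ℝ :=
  ∫ ω, rep (energy v ω) f ∂stdGauss I

/-- The quenched logarithm of the partition function. -/
def logPart (v : I → S → ℝ) : ℝ :=
  ∫ ω, Real.log (∑ s, Real.exp (energy v ω s)) ∂stdGauss I

/-- The covariance of the Gaussian exponents. -/
def cov (v : I → S → ℝ) (s s' : S) : ℝ := ∑ i, v i s * v i s'

lemma continuous_energy (v : I → S → ℝ) : Continuous (energy v) := by
  unfold energy; fun_prop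

lemma exists_bound {X : Type*} [Finite X] (f : X → ℝ) : ∃ A, 0 ≤ A ∧ ∀ x, |f x| ≤ A := by
  obtain ⟨A, hA⟩ := (Set.finite_range fun x => |f x|).bddAbove
  exact ⟨max A 0, le_max_right _ _, fun x => (hA ⟨x, rfl⟩).trans (le_max_left _ _)⟩

variable [Nonempty S]

lemma continuous_rep_energy {n : ℕ} (v : I → S → ℝ) (f : (Fin n → S) → ℝ) :
    Continuous fun ω => rep (energy v ω) f := (continuous_rep f).comp (continuous_energy v)

lemma integrable_rep {n : ℕ} (v : I → S → ℝ) (f : (Fin n → S) → ℝ) :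
    Integrable (fun ω => rep (energy v ω) f) (stdGauss I) := by
  obtain ⟨A, _, hA⟩ := exists_bound f
  exact integrable_bounded_continuous (continuous_rep_energy v f) fun ω => abs_rep_le _ hA

lemma gavg_add {n : ℕ} (v : I → S → ℝ) (f g : (Fin n → S) → ℝ) :
    gavg v (fun τ => f τ + g τ) = gavg v f + gavg v g := by
  simp only [gavg, rep_add]
  exact integral_add (integrable_rep v f) (integrable_rep v g)

lemma gavg_sub {n : ℕ} (v : I → S → ℝ) (f g : (Fin n → S) → ℝ) :
    gavg v (fun τ => f τ - g τ) = gavg v f - gavg v g := by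
  simp only [gavg, rep_sub]
  exact integral_sub (integrable_rep v f) (integrable_rep v g)

lemma gavg_mul_left {n : ℕ} (v : I → S → ℝ) (c : ℝ) (f : (Fin n → S) → ℝ) :
    gavg v (fun τ => c * f τ) = c * gavg v f := by
  simp only [gavg, rep_mul_left]
  exact integral_const_mul _ _

lemma gavg_sum {n : ℕ} {κ : Type*} (t : Finset κ) (v : I → S → ℝ) (f : κ → (Fin n → S) → ℝ) :
    gavg v (fun τ => ∑ k ∈ t, f k τ) = ∑ k ∈ t, gavg v (f k) := by
  simp only [gavg, rep_sum]
  exact integral_finsetSum _ fun k _ => integrable_rep v (f k)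

lemma gavg_mono {n : ℕ} (v : I → S → ℝ) {f g : (Fin n → S) → ℝ} (h : ∀ τ, f τ ≤ g τ) :
    gavg v f ≤ gavg v g :=
  integral_mono (integrable_rep v f) (integrable_rep v g) fun _ => rep_mono _ h

lemma gavg_const {n : ℕ} (v : I → S → ℝ) (c : ℝ) : gavg v (fun _ : Fin n → S => c) = c := by
  simp [gavg, rep_const]

lemma abs_gavg_le {n : ℕ} (v : I → S → ℝ) {f : (Fin n → S) → ℝ} {A : ℝ} (h : ∀ τ, |f τ| ≤ A) :
    |gavg v f| ≤ A := by
  rw [abs_le]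
  constructor
  · rw [← gavg_const (n := n) v (-A)]
    exact gavg_mono v fun τ => (abs_le.1 (h τ)).1
  · rw [← gavg_const (n := n) v A]
    exact gavg_mono v fun τ => (abs_le.1 (h τ)).2

lemma rep_conn_energy {n : ℕ} (v v' : I → S → ℝ) (f : (Fin n → S) → ℝ) (ω : I → ℝ) :
    rep (energy v ω) (conn (energy v' ω) f) =
      ∑ i, ω i * rep (energy v ω) (conn (v' i) f) := by
  have : conn (energy v' ω) f = fun τ => ∑ i, ω i * conn (v' i) f τ := by
    ext τ
    unfold energy
    rw [conn_sum]
    simp only [conn_mul]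
  rw [this, rep_sum]
  simp only [rep_mul_left]

lemma integral_coord_mul_rep {n : ℕ} (v : I → S → ℝ) (f : (Fin n → S) → ℝ) (k : I) :
    ∫ ω, ω k * rep (energy v ω) f ∂stdGauss I = gavg v (conn (v k) f) := by
  classical
  obtain ⟨A, _, hA⟩ := exists_bound f
  obtain ⟨B, _, hB⟩ := exists_bound (conn (v k) f)
  refine stdGauss_ibp k (fun ω t => ?_) (continuous_rep_energy v f)
    (continuous_rep_energy v _) (fun ω => abs_rep_le _ hA) (fun ω => abs_rep_le _ hB)
  refine hasDerivAt_rep f fun s => ?_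
  unfold energy
  have : HasDerivAt (fun t => ∑ i, Function.update ω k t i * v i s)
      (∑ i, (if i = k then 1 else 0) * v i s) t := by
    refine HasDerivAt.fun_sum fun i _ => HasDerivAt.mul_const ?_ _
    by_cases h : i = k
    · subst h; simpa using hasDerivAt_id' t
    · simpa [Function.update_of_ne h, h] using hasDerivAt_const t (ω i)
  simpa using this

/-- Each Gaussian factor is traded, by parts, for a second insertion of `conn`. Hence one derivative
of a quenched average costs two replicas. -/
lemma integral_rep_conn_energy {n : ℕ} (v v' : I → S → ℝ) (f : (Fin n → S) → ℝ) :
    ∫ ω, rep (energy v ω) (conn (energy v' ω) f) ∂stdGauss I =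
      gavg v (fun τ => ∑ i, conn (v i) (conn (v' i) f) τ) := by
  simp only [rep_conn_energy]
  rw [integral_finsetSum, gavg_sum]
  · exact Finset.sum_congr rfl fun i _ => integral_coord_mul_rep v _ i
  · intro i _
    obtain ⟨A, _, hA⟩ := exists_bound (conn (v' i) f)
    exact integrable_coord_mul i (continuous_rep_energy v _) fun ω => abs_rep_le _ hA

lemma conn_one (φ ψ : S → ℝ) (τ : Fin 2 → S) :
    conn φ (fun τ : Fin 1 → S => ψ (τ 0)) τ = ψ (τ 0) * (φ (τ 0) - φ (τ 1)) := by
  simp [conn, Fin.init]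

/-- Integration by parts for the mean of a Gaussian exponent. -/
lemma integral_rep_energy (v v' : I → S → ℝ) :
    ∫ ω, rep (energy v ω) (fun τ : Fin 1 → S => energy v' ω (τ 0)) ∂stdGauss I =
      gavg v (fun τ : Fin 2 → S => ∑ i, v' i (τ 0) * (v i (τ 0) - v i (τ 1))) := by
  unfold energy
  simp only [rep_sum, rep_mul_left]
  rw [integral_finsetSum, gavg_sum]
  · refine Finset.sum_congr rfl fun i _ => ?_
    refine (integral_coord_mul_rep v _ i).trans ?_
    congr 1; ext τ
    rw [conn_one]
  · intro i _
    obtain ⟨A, _, hA⟩ := exists_bound (fun τ : Fin 1 → S => v' i (τ 0))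
    exact integrable_coord_mul i (continuous_rep_energy v _) fun ω => abs_rep_le _ hA

lemma abs_energy_le (v : I → S → ℝ) {B : ℝ} (hB : ∀ i s, |v i s| ≤ B) (ω : I → ℝ) (s : S) :
    |energy v ω s| ≤ ∑ i, |ω i| * B :=
  (Finset.abs_sum_le_sum_abs _ _).trans (Finset.sum_le_sum fun i _ => by
    rw [abs_mul]; exact mul_le_mul_of_nonneg_left (hB i s) (abs_nonneg _))

lemma integrable_sum_abs (B : ℝ) : Integrable (fun ω : I → ℝ => ∑ i, |ω i| * B) (stdGauss I) :=
  integrable_finsetSum _ fun i _ => (integrable_coord i).abs.mul_const B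

lemma abs_log_sum_exp_le {E : S → ℝ} {A : ℝ} (h : ∀ s, |E s| ≤ A) :
    |Real.log (∑ s, Real.exp (E s))| ≤ A + Real.log (Fintype.card S) := by
  have hc : (1 : ℝ) ≤ Fintype.card S := by exact_mod_cast Fintype.card_pos
  have hl := Real.log_nonneg hc
  rw [abs_le]
  constructor
  · obtain ⟨s⟩ := ‹Nonempty S›
    have : Real.exp (-A) ≤ ∑ s, Real.exp (E s) :=
      (Real.exp_le_exp.2 (abs_le.1 (h s)).1).trans
        (Finset.single_le_sum (f := fun s => Real.exp (E s)) (fun _ _ => (Real.exp_pos _).le)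
          (Finset.mem_univ s))
    have := Real.log_le_log (Real.exp_pos _) this
    rw [Real.log_exp] at this
    linarith
  · have : ∑ s, Real.exp (E s) ≤ Fintype.card S * Real.exp A := by
      have := Finset.sum_le_card_nsmul Finset.univ (fun s => Real.exp (E s)) (Real.exp A)
        fun s _ => Real.exp_le_exp.2 (abs_le.1 (h s)).2
      simpa using this
    have := Real.log_le_log (sum_exp_pos E) this
    rw [Real.log_mul (by positivity) (Real.exp_pos _).ne', Real.log_exp] at this
    linarith

lemma continuous_log_sum_exp : Continuous fun E : S → ℝ => Real.log (∑ s, Real.exp (E s)) :=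
  Continuous.log (by fun_prop) fun E => (sum_exp_pos E).ne'

lemma integrable_log_part (v : I → S → ℝ) :
    Integrable (fun ω => Real.log (∑ s, Real.exp (energy v ω s))) (stdGauss I) := by
  obtain ⟨B, _, hB⟩ := exists_bound (fun p : I × S => v p.1 p.2)
  refine Integrable.mono' ((integrable_sum_abs B).add (integrable_const _))
    (continuous_log_sum_exp.comp (continuous_energy v)).aestronglyMeasurable
    (ae_of_all _ fun ω => abs_log_sum_exp_le fun s => abs_energy_le v (fun i s => hB (i, s)) ω s)

section Derivative

variable {v v' : ℝ → I → S → ℝ} {B : ℝ}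

lemma hasDerivAt_energy (hv : ∀ u i s, HasDerivAt (fun u => v u i s) (v' u i s) u)
    (ω : I → ℝ) (s : S) (u : ℝ) :
    HasDerivAt (fun u => energy (v u) ω s) (energy (v' u) ω s) u :=
  HasDerivAt.fun_sum fun i _ => (hv u i s).const_mul _

lemma abs_conn_le {n : ℕ} {φ : S → ℝ} {f : (Fin n → S) → ℝ} {A B : ℝ} (hA : ∀ τ, |f τ| ≤ A)
    (hB : ∀ s, |φ s| ≤ B) (τ : Fin (n + 1) → S) : |conn φ f τ| ≤ A * (2 * n * B) := by
  rw [conn, abs_mul]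
  refine mul_le_mul (hA _) ?_ (abs_nonneg _) ((abs_nonneg _).trans (hA (Fin.init τ)))
  have h1 : |∑ a : Fin n, φ (τ a.castSucc)| ≤ n * B := by
    refine (Finset.abs_sum_le_sum_abs _ _).trans ?_
    have := Finset.sum_le_card_nsmul Finset.univ (fun a : Fin n => |φ (τ a.castSucc)|) B
      fun a _ => hB _
    simpa using this
  have h2 : |(n : ℝ) * φ (τ (Fin.last n))| ≤ n * B := by
    rw [abs_mul, Nat.abs_cast]
    exact mul_le_mul_of_nonneg_left (hB _) (Nat.cast_nonneg _)
  have := abs_sub (∑ a : Fin n, φ (τ a.castSucc)) ((n : ℝ) * φ (τ (Fin.last n)))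
  linarith

lemma hasDerivAt_gavg {n : ℕ} (hv : ∀ u i s, HasDerivAt (fun u => v u i s) (v' u i s) u)
    (hB : ∀ u i s, |v' u i s| ≤ B) (f : (Fin n → S) → ℝ) (u : ℝ) :
    HasDerivAt (fun u => gavg (v u) f)
      (gavg (v u) fun τ => ∑ i, conn (v u i) (conn (v' u i) f) τ) u := by
  obtain ⟨A, hA0, hA⟩ := exists_bound f
  rw [← integral_rep_conn_energy]
  refine (hasDerivAt_integral_of_dominated_loc_of_deriv_le (s := Set.univ) univ_mem
    (F := fun u ω => rep (energy (v u) ω) f)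
    (F' := fun u ω => rep (energy (v u) ω) (conn (energy (v' u) ω) f))
    (bound := fun ω => A * (2 * n * ∑ i, |ω i| * B))
    (Eventually.of_forall fun u => (continuous_rep_energy (v u) f).aestronglyMeasurable)
    (integrable_rep _ f) ?_ (ae_of_all _ fun ω u _ => ?_) ?_
    (ae_of_all _ fun ω u _ => hasDerivAt_rep f fun s => hasDerivAt_energy hv ω s u)).2
  · simp only [rep_conn_energy]
    refine Continuous.aestronglyMeasurable (continuous_finsetSum _ fun i _ =>
      (continuous_apply i).mul (continuous_rep_energy _ _))
  · exact abs_rep_le _ fun τ => abs_conn_le hA (fun s => abs_energy_le _ (hB u) ω s) τ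
  · exact ((integrable_sum_abs B).const_mul _).const_mul _

lemma hasDerivAt_logPart (hv : ∀ u i s, HasDerivAt (fun u => v u i s) (v' u i s) u)
    (hB : ∀ u i s, |v' u i s| ≤ B) (u : ℝ) :
    HasDerivAt (fun u => logPart (v u))
      (gavg (v u) fun τ : Fin 2 → S => ∑ i, v' u i (τ 0) * (v u i (τ 0) - v u i (τ 1))) u := by
  rw [← integral_rep_energy]
  refine (hasDerivAt_integral_of_dominated_loc_of_deriv_le (s := Set.univ) univ_mem
    (F := fun u ω => Real.log (∑ s, Real.exp (energy (v u) ω s)))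
    (F' := fun u ω => rep (energy (v u) ω) (fun τ : Fin 1 → S => energy (v' u) ω (τ 0)))
    (bound := fun ω => ∑ i, |ω i| * B)
    (Eventually.of_forall fun u =>
      (continuous_log_sum_exp.comp (continuous_energy (v u))).aestronglyMeasurable)
    (integrable_log_part _) ?_ (ae_of_all _ fun ω u _ => ?_) (integrable_sum_abs B)
    (ae_of_all _ fun ω u _ => hasDerivAt_log_sum_exp fun s => hasDerivAt_energy hv ω s u)).2
  · unfold energy
    simp only [rep_sum, rep_mul_left]
    refine Continuous.aestronglyMeasurable (continuous_finsetSum _ fun i _ =>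
      (continuous_apply i).mul (continuous_rep_energy _ _))
  · exact abs_rep_le _ fun τ => abs_energy_le _ (hB u) ω _

end Derivative

end Gaussian

/-! ### Gaussian comparison of quenched log-partition functions. -/

section Comparison

variable {S I J : Type*} [Fintype S] [Fintype I] [Fintype J]

lemma measurePreserving_sum :
    MeasurePreserving (fun ω : I ⊕ J → ℝ => (ω ∘ Sum.inl, ω ∘ Sum.inr)) (stdGauss (I ⊕ J))
      ((stdGauss I).prod (stdGauss J)) :=
  measurePreserving_sumPiEquivProdPi fun _ : I ⊕ J => gaussianReal 0 1

lemma measurePreserving_inl :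
    MeasurePreserving (fun ω : I ⊕ J → ℝ => ω ∘ Sum.inl) (stdGauss (I ⊕ J)) (stdGauss I) :=
  measurePreserving_fst.comp measurePreserving_sum

lemma measurePreserving_inr :
    MeasurePreserving (fun ω : I ⊕ J → ℝ => ω ∘ Sum.inr) (stdGauss (I ⊕ J)) (stdGauss J) :=
  measurePreserving_snd.comp measurePreserving_sum

variable [Nonempty S]

lemma logPart_sum_zero (v : I → S → ℝ) :
    logPart (Sum.elim v fun (_ : J) _ => 0) = logPart v := by
  have mp := measurePreserving_inl (I := I) (J := J)
  rw [logPart, logPart, ← mp.map_eq, integral_map mp.measurable.aemeasurable]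
  · simp [energy, Fintype.sum_sum_type]
  · exact (continuous_log_sum_exp.comp (continuous_energy v)).aestronglyMeasurable

lemma logPart_zero_sum (v : J → S → ℝ) :
    logPart (Sum.elim (fun (_ : I) _ => 0) v) = logPart v := by
  have mp := measurePreserving_inr (I := I) (J := J)
  rw [logPart, logPart, ← mp.map_eq, integral_map mp.measurable.aemeasurable]
  · simp [energy, Fintype.sum_sum_type]
  · exact (continuous_log_sum_exp.comp (continuous_energy v)).aestronglyMeasurable

/-- Gaussian comparison: the quenched log-partition function is controlled by the increments
of the covariance. -/
theorem logPart_le_of_cov (v : I → S → ℝ) (v' : J → S → ℝ) (c : ℝ)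
    (h : ∀ s s', cov v s s - cov v s s' ≤ cov v' s s - cov v' s s' + c) :
    logPart v ≤ logPart v' + c / 2 := by
  -- The rotation is smooth up to both endpoints, unlike the interpolation with square roots. The
  -- derivative of the log-partition function is `sin * cos` times the difference of the covariance
  -- increments, and `c / 2 * sin ^ 2` makes the total nondecreasing.
  set w : ℝ → I ⊕ J → S → ℝ := fun θ =>
    Sum.elim (fun i s => Real.cos θ * v i s) (fun j s => Real.sin θ * v' j s) with hw
  set w' : ℝ → I ⊕ J → S → ℝ := fun θ =>
    Sum.elim (fun i s => -Real.sin θ * v i s) (fun j s => Real.cos θ * v' j s) with hw'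
  have hd : ∀ u i s, HasDerivAt (fun u => w u i s) (w' u i s) u := by
    rintro u (i | j) s
    · exact (Real.hasDerivAt_cos u).mul_const _
    · exact (Real.hasDerivAt_sin u).mul_const _
  obtain ⟨A, hA0, hA⟩ := exists_bound (fun p : I × S => v p.1 p.2)
  obtain ⟨A', hA0', hA'⟩ := exists_bound (fun p : J × S => v' p.1 p.2)
  have hB : ∀ u i s, |w' u i s| ≤ max A A' := by
    rintro u (i | j) s
    · simp only [hw', Sum.elim_inl, abs_mul, abs_neg]
      exact (mul_le_of_le_one_left (abs_nonneg _) (Real.abs_sin_le_one u)).trans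
        ((hA (i, s)).trans (le_max_left _ _))
    · simp only [hw', Sum.elim_inr, abs_mul]
      exact (mul_le_of_le_one_left (abs_nonneg _) (Real.abs_cos_le_one u)).trans
        ((hA' (j, s)).trans (le_max_right _ _))
  have hder := fun u => hasDerivAt_logPart hd hB u
  have hF : ∀ u, HasDerivAt (fun u => logPart (w u) + c / 2 * Real.sin u ^ 2)
      (gavg (w u) (fun τ : Fin 2 → S => ∑ i, w' u i (τ 0) * (w u i (τ 0) - w u i (τ 1)))
        + c * Real.sin u * Real.cos u) u := by
    intro u
    convert! (hder u).add (((Real.hasDerivAt_sin u).pow 2).const_mul (c / 2)) using 1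
    push_cast
    ring
  have hmono : MonotoneOn (fun u => logPart (w u) + c / 2 * Real.sin u ^ 2)
      (Set.Icc 0 (Real.pi / 2)) := by
    refine monotoneOn_of_deriv_nonneg (convex_Icc _ _)
      (fun u _ => (hF u).continuousAt.continuousWithinAt)
      (fun u _ => (hF u).differentiableAt.differentiableWithinAt) fun u hu => ?_
    rw [interior_Icc] at hu
    rw [(hF u).deriv, ← gavg_const (n := 2) (w u) (c * Real.sin u * Real.cos u), ← gavg_add,
      ← gavg_const (n := 2) (w u) 0]
    refine gavg_mono _ fun τ => ?_
    have hs : 0 < Real.sin u := Real.sin_pos_of_pos_of_lt_pi hu.1 (by linarith [hu.2, Real.pi_pos])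
    have hc : 0 < Real.cos u := Real.cos_pos_of_mem_Ioo ⟨by linarith [hu.1, Real.pi_pos], hu.2⟩
    have e : ∑ i, w' u i (τ 0) * (w u i (τ 0) - w u i (τ 1)) =
        Real.sin u * Real.cos u * ((cov v' (τ 0) (τ 0) - cov v' (τ 0) (τ 1)) -
          (cov v (τ 0) (τ 0) - cov v (τ 0) (τ 1))) := by
      simp only [Fintype.sum_sum_type, hw, hw', Sum.elim_inl, Sum.elim_inr, cov,
        ← Finset.sum_sub_distrib, mul_sub, Finset.mul_sum]
      rw [add_comm, sub_eq_add_neg, ← Finset.sum_neg_distrib]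
      congr 1
      · exact Finset.sum_congr rfl fun i _ => by ring
      · exact Finset.sum_congr rfl fun i _ => by ring
    rw [e]
    have := mul_nonneg (mul_pos hs hc).le (sub_nonneg.2 (h (τ 0) (τ 1)))
    linarith
  have h0 := hmono ⟨le_rfl, by positivity⟩ ⟨by positivity, le_rfl⟩ (by positivity : 0 ≤ Real.pi / 2)
  have e0 : w 0 = Sum.elim v fun _ _ => 0 := by
    ext (i | j) s <;> simp [hw]
  have e1 : w (Real.pi / 2) = Sum.elim (fun _ _ => 0) v' := by
    ext (i | j) s <;> simp [hw]
  simp only [e0, e1, logPart_sum_zero, logPart_zero_sum, Real.sin_zero, Real.sin_pi_div_two] at h0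
  linarith

/-- Comparison in both directions with `c = 0`. It identifies models built on different families of
Gaussians. -/
lemma logPart_congr_cov (v : I → S → ℝ) (v' : J → S → ℝ)
    (h : ∀ s s', cov v s s - cov v s s' = cov v' s s - cov v' s s') : logPart v = logPart v' := by
  apply le_antisymm
  · simpa using logPart_le_of_cov v v' 0 fun s s' => by rw [h]; simp
  · simpa using logPart_le_of_cov v' v 0 fun s s' => by rw [h]; simp

lemma logPart_equiv {T : Type*} [Fintype T] (e : T ≃ S) (v : I → S → ℝ) :
    logPart (fun i t => v i (e t)) = logPart v := by
  simp only [logPart, energy]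
  congr 1; ext ω
  rw [← e.sum_comp]

end Comparison

/-! ### The SK model as a family of Gaussian exponents. -/

section Link

variable {N : ℕ}

/-- Coefficients of the SK exponents, with amplitude `r` of the external field. -/
def skVec (N : ℕ) (β r : ℝ) : Couple N ⊕ Fin N → Config N → ℝ :=
  Sum.elim (fun p σ => β / √(N : ℝ) * (spin σ p.1.1 * spin σ p.1.2)) (fun i σ => r * spin σ i)

lemma energy_skVec (β r : ℝ) (ω : Couple N ⊕ Fin N → ℝ) (σ : Config N) :
    energy (skVec N β r) ω σ =
      -β * hamiltonian (ω ∘ Sum.inl) σ + r * ∑ i, (ω ∘ Sum.inr) i * spin σ i := by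
  simp only [energy, Fintype.sum_sum_type, skVec, Sum.elim_inl, Sum.elim_inr, hamiltonian,
    Finset.mul_sum, Function.comp]
  congr 1
  · exact Finset.sum_congr rfl fun p _ => by ring
  · exact Finset.sum_congr rfl fun p _ => by ring

lemma average_eq_gavg {n : ℕ} (β x : ℝ) (A : (Fin n → Config N) → ℝ) :
    average N β x A = gavg (skVec N β √x) A := by
  have e : ∀ ω : Couple N ⊕ Fin N → ℝ, rep (energy (skVec N β √x) ω) A =
      replicaExp β x (ω ∘ Sum.inl, ω ∘ Sum.inr) A := by
    intro ω
    simp only [rep, replicaExp, gw, gibbs, partition, boltzmann, energy_skVec]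
  rw [average, gavg]
  simp only [e]
  exact ((measurePreserving_sumPiEquivProdPi
    fun _ : Couple N ⊕ Fin N => gaussianReal 0 1).integral_comp'
      fun p : Disorder N => replicaExp β x p A).symm

lemma spin_mul_self (σ : Config N) (i : Fin N) : spin σ i * spin σ i = 1 := by
  rcases Int.units_eq_one_or (σ i) with h | h <;> simp [spin, h]

lemma abs_spin (σ : Config N) (i : Fin N) : |spin σ i| = 1 := by
  rcases Int.units_eq_one_or (σ i) with h | h <;> simp [spin, h]

/-- The overlap of two configurations. -/
def overlap (σ σ' : Config N) : ℝ := (1 / (N : ℝ)) * ∑ i, spin σ i * spin σ' i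

lemma q_eq_overlap {n : ℕ} (a b : Fin n) (τ : Fin n → Config N) :
    q a b τ = overlap (τ a) (τ b) := rfl

lemma overlap_comm (σ σ' : Config N) : overlap σ σ' = overlap σ' σ := by
  simp [overlap, mul_comm]

lemma sum_spin_mul (σ σ' : Config N) : ∑ i, spin σ i * spin σ' i = N * overlap σ σ' := by
  rcases Nat.eq_zero_or_pos N with rfl | h
  · simp
  · have : (N : ℝ) ≠ 0 := by positivity
    rw [overlap]; field_simp

lemma overlap_self (hN : 0 < N) (σ : Config N) : overlap σ σ = 1 := by
  have : (N : ℝ) ≠ 0 := by positivity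
  simp [overlap, spin_mul_self, this]

lemma abs_overlap_le (σ σ' : Config N) : |overlap σ σ'| ≤ 1 := by
  rcases Nat.eq_zero_or_pos N with rfl | h
  · simp [overlap]
  · have hN : (0 : ℝ) < N := by positivity
    rw [overlap, abs_mul, abs_of_pos (by positivity), one_div, inv_mul_le_iff₀ hN, mul_one]
    refine (Finset.abs_sum_le_sum_abs _ _).trans ?_
    simp [abs_mul, abs_spin]

lemma sum_couples (g : Fin N → ℝ) :
    ∑ p : Couple N, g p.1.1 * g p.1.2 = ((∑ i, g i) ^ 2 - ∑ i, g i ^ 2) / 2 := by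
  have h1 : ∑ p : Couple N, g p.1.1 * g p.1.2 =
      ∑ p : Fin N × Fin N with p.1 < p.2, g p.1 * g p.2 := by
    rw [Finset.sum_subtype (p := fun p : Fin N × Fin N => p.1 < p.2)]
    simp
  have h2 : ∑ p : Fin N × Fin N with p.2 < p.1, g p.1 * g p.2 =
      ∑ p : Fin N × Fin N with p.1 < p.2, g p.1 * g p.2 := by
    refine Finset.sum_equiv (Equiv.prodComm _ _) (by simp) (by simp [mul_comm])
  have h3 : ∑ p : Fin N × Fin N with p.1 = p.2, g p.1 * g p.2 = ∑ i, g i ^ 2 := by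
    rw [Finset.sum_filter, Fintype.sum_prod_type]
    simp [sq]
  have h4 : (∑ i, g i) ^ 2 = ∑ p : Fin N × Fin N, g p.1 * g p.2 := by
    rw [sq, Finset.sum_mul_sum, ← Fintype.sum_prod_type']
  have h5 : ∑ p : Fin N × Fin N, g p.1 * g p.2 =
      ∑ p : Fin N × Fin N with p.1 < p.2, g p.1 * g p.2 +
      ∑ p : Fin N × Fin N with p.2 < p.1, g p.1 * g p.2 +
      ∑ p : Fin N × Fin N with p.1 = p.2, g p.1 * g p.2 := by
    simp only [Finset.sum_filter, ← Finset.sum_add_distrib]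
    refine Finset.sum_congr rfl fun p _ => ?_
    rcases lt_trichotomy p.1 p.2 with h | h | h
    · simp [h, h.ne, h.not_gt]
    · simp [h]
    · simp [h, h.ne', h.not_gt]
  rw [h1, h4, h5, h2, h3]
  ring

/-- Summing over couples instead of all pairs leaves a constant coming from the diagonal, absent
when `N = 0`. It cancels in the increments used for comparison. -/
lemma cov_skVec (β r : ℝ) (σ σ' : Config N) :
    cov (skVec N β r) σ σ' =
      β ^ 2 / 2 * (N * overlap σ σ' ^ 2 - if N = 0 then 0 else 1) + r ^ 2 * N * overlap σ σ' := by
  have h := sum_couples fun i => spin σ i * spin σ' i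
  have h2 : ∑ i, (spin σ i * spin σ' i) ^ 2 = N := by
    have (i : Fin N) : (spin σ i * spin σ' i) ^ 2 = 1 := by
      rw [mul_pow, sq, sq, spin_mul_self, spin_mul_self, one_mul]
    simp [this]
  rw [h2, sum_spin_mul] at h
  simp only [cov, Fintype.sum_sum_type, skVec, Sum.elim_inl, Sum.elim_inr]
  have e1 : ∑ p : Couple N, β / √(N : ℝ) * (spin σ p.1.1 * spin σ p.1.2) *
      (β / √(N : ℝ) * (spin σ' p.1.1 * spin σ' p.1.2)) = β ^ 2 / N *
      ∑ p : Couple N, (spin σ p.1.1 * spin σ' p.1.1) * (spin σ p.1.2 * spin σ' p.1.2) := by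
    rw [Finset.mul_sum]
    refine Finset.sum_congr rfl fun p _ => ?_
    have : (√(N : ℝ))⁻¹ ^ 2 = (N : ℝ)⁻¹ := by rw [inv_pow, Real.sq_sqrt (Nat.cast_nonneg N)]
    rw [div_eq_mul_inv, div_eq_mul_inv, ← this]
    ring
  have e2 : ∑ i, r * spin σ i * (r * spin σ' i) = r ^ 2 * (N * overlap σ σ') := by
    rw [← sum_spin_mul, Finset.mul_sum]
    exact Finset.sum_congr rfl fun p _ => by ring
  rw [e1, e2, h]
  rcases Nat.eq_zero_or_pos N with rfl | hN
  · simp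
  · have : (N : ℝ) ≠ 0 := by positivity
    rw [if_neg hN.ne']
    field_simp

end Link

/-! ### Exchangeability of replicas and insertions of a centred spin. -/

section Perm

variable {S I : Type*} [Fintype S] [Fintype I]

lemma rep_perm {n : ℕ} (E : S → ℝ) (e : Equiv.Perm (Fin n)) (f : (Fin n → S) → ℝ) :
    rep E (fun τ => f (τ ∘ e)) = rep E f := by
  simp only [rep]
  rw [← (Equiv.arrowCongr e (Equiv.refl S)).sum_comp fun τ : Fin n → S =>
    f (τ ∘ e) * ∏ a, gw E (τ a)]
  refine Finset.sum_congr rfl fun τ _ => ?_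
  have h1 : (Equiv.arrowCongr e (Equiv.refl S)) τ ∘ e = τ := by
    ext a; simp [Equiv.arrowCongr]
  rw [h1]
  congr 1
  rw [← Equiv.prod_comp e]
  simp [Equiv.arrowCongr]

lemma gavg_perm {n : ℕ} (v : I → S → ℝ) (e : Equiv.Perm (Fin n)) (f : (Fin n → S) → ℝ) :
    gavg v (fun τ => f (τ ∘ e)) = gavg v f := by
  simp only [gavg, rep_perm]

lemma gavg_init [Nonempty S] {n : ℕ} (v : I → S → ℝ) (f : (Fin n → S) → ℝ) :
    gavg v (fun τ : Fin (n + 1) → S => f (Fin.init τ)) = gavg v f := by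
  simp only [gavg, rep_init]

/-- The outer fresh replica enters linearly and averages to zero. The inner one survives only
through its square, which is `1`; this gives the `-n`. -/
lemma rep_conn_conn [Nonempty S] {n : ℕ} {E φ : S → ℝ} (h0 : ∑ s, φ s * gw E s = 0)
    (h1 : ∀ s, φ s * φ s = 1) (f : (Fin n → S) → ℝ) :
    rep E (conn φ (conn φ f)) = rep E fun τ => f τ * ((∑ a, φ (τ a)) ^ 2 - n) := by
  rw [rep_conn, h0, mul_zero, zero_mul, sub_zero, rep_succ]
  congr 1; ext τ
  have e : ∀ s, conn φ f (Fin.snoc τ s) * (∑ a, φ (Fin.snoc (α := fun _ => S) τ s a)) * gw E s =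
      f τ * ((∑ a, φ (τ a)) ^ 2 - n) * gw E s
        + f τ * ((1 - n) * ∑ a, φ (τ a)) * (φ s * gw E s) := by
    intro s
    rw [Fin.sum_univ_castSucc]
    simp only [conn, Fin.init_snoc, Fin.snoc_castSucc, Fin.snoc_last]
    linear_combination -(f τ) * n * gw E s * h1 s
  simp only [e]
  rw [Finset.sum_add_distrib, ← Finset.mul_sum, ← Finset.mul_sum, h0, sum_gw]
  ring

end Perm

/-! ### Spin-flip symmetry at zero field. -/

section Flip

variable {N : ℕ}

lemma spin_neg (σ : Config N) (i : Fin N) : spin (-σ) i = -spin σ i := by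
  simp [spin]

lemma energy_skVec_neg (β : ℝ) (ω : Couple N ⊕ Fin N → ℝ) (σ : Config N) :
    energy (skVec N β 0) ω (-σ) = energy (skVec N β 0) ω σ := by
  simp [energy, skVec, Fintype.sum_sum_type, spin_neg]

lemma gw_skVec_neg (β : ℝ) (ω : Couple N ⊕ Fin N → ℝ) (σ : Config N) :
    gw (energy (skVec N β 0) ω) (-σ) = gw (energy (skVec N β 0) ω) σ := by
  simp only [gw, energy_skVec_neg]

lemma sum_odd_mul_gw (β : ℝ) (ω : Couple N ⊕ Fin N → ℝ) {φ : Config N → ℝ}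
    (h : ∀ σ, φ (-σ) = -φ σ) : ∑ σ, φ σ * gw (energy (skVec N β 0) ω) σ = 0 := by
  have := Equiv.sum_comp (Equiv.neg (Config N)) fun σ => φ σ * gw (energy (skVec N β 0) ω) σ
  simp only [Equiv.neg_apply, h, gw_skVec_neg, neg_mul, Finset.sum_neg_distrib] at this
  linarith

/-- Without field, a function that is odd in one of the replicas averages to zero. -/
lemma gavg_odd {n : ℕ} (β : ℝ) (a : Fin n) {f : (Fin n → Config N) → ℝ}
    (h : ∀ τ, f (Function.update τ a (-τ a)) = -f τ) : gavg (skVec N β 0) f = 0 := by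
  have hr : ∀ ω, rep (energy (skVec N β 0) ω) f = 0 := by
    intro ω
    have hi : Function.Involutive fun τ : Fin n → Config N => Function.update τ a (-τ a) := by
      intro τ; simp
    have := Equiv.sum_comp hi.toPerm fun τ => f τ * ∏ b, gw (energy (skVec N β 0) ω) (τ b)
    have e : ∀ τ : Fin n → Config N, ∏ b, gw (energy (skVec N β 0) ω)
        (Function.update τ a (-τ a) b) = ∏ b, gw (energy (skVec N β 0) ω) (τ b) := by
      intro τ
      refine Finset.prod_congr rfl fun b _ => ?_
      by_cases hb : b = a
      · subst hb; simp [gw_skVec_neg]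
      · rw [Function.update_of_ne hb]
    simp only [Function.Involutive.coe_toPerm, h, e, neg_mul, Finset.sum_neg_distrib] at this
    rw [rep]; linarith
  simp [gavg, hr]

lemma overlap_neg_left (σ σ' : Config N) : overlap (-σ) σ' = -overlap σ σ' := by
  simp [overlap, spin_neg]

lemma overlap_neg_right (σ σ' : Config N) : overlap σ (-σ') = -overlap σ σ' := by
  rw [overlap_comm, overlap_neg_left, overlap_comm]

end Flip

/-! ### Derivatives in the field variance and their zero-field values. -/

section Field

variable {N : ℕ}

/-- The average in a random field of variance `y² / N`. -/
def fieldAvg (N : ℕ) {n : ℕ} (β : ℝ) (f : (Fin n → Config N) → ℝ) (y : ℝ) : ℝ :=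
  gavg (skVec N β (y / √(N : ℝ))) f

lemma average_eq_fieldAvg {n : ℕ} (β y : ℝ) (f : (Fin n → Config N) → ℝ) :
    average N β (y ^ 2 / N) f = fieldAvg N β f |y| := by
  rw [average_eq_gavg, fieldAvg, Real.sqrt_div (sq_nonneg y), Real.sqrt_sq_eq_abs]

lemma average_zero_eq {n : ℕ} (β : ℝ) (f : (Fin n → Config N) → ℝ) :
    average N β 0 f = gavg (skVec N β 0) f := by
  rw [average_eq_gavg, Real.sqrt_zero]

lemma fieldAvg_zero {n : ℕ} (β : ℝ) (f : (Fin n → Config N) → ℝ) :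
    fieldAvg N β f 0 = gavg (skVec N β 0) f := by
  rw [fieldAvg, zero_div]

/-- The function of two more replicas that generates the derivative in the field variance. -/
def lap {n : ℕ} (f : (Fin n → Config N) → ℝ) (τ : Fin (n + 2) → Config N) : ℝ :=
  1 / (2 * (N : ℝ)) * ∑ i, conn (fun σ => spin σ i) (conn (fun σ => spin σ i) f) τ

lemma hasDerivAt_skVec (β y : ℝ) (i : Couple N ⊕ Fin N) (σ : Config N) :
    HasDerivAt (fun y => skVec N β (y / √(N : ℝ)) i σ) (skVec N 0 (1 / √(N : ℝ)) i σ) y := by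
  rcases i with p | i
  · simpa [skVec] using hasDerivAt_const y _
  · simpa [skVec] using ((hasDerivAt_id' y).div_const (√(N : ℝ))).mul_const (spin σ i)

lemma abs_skVec_zero_le (r : ℝ) (i : Couple N ⊕ Fin N) (σ : Config N) :
    |skVec N 0 r i σ| ≤ |r| := by
  rcases i with p | i
  · simp [skVec]
  · simp [skVec, abs_mul, abs_spin]

lemma inv_sqrt_mul_self : 1 / √(N : ℝ) * (1 / √(N : ℝ)) = 1 / N := by
  rw [← sq, div_pow, Real.sq_sqrt (Nat.cast_nonneg N), one_pow]

/-- Only the field coefficients move with `y`. Their amplitude `y / √N` times its derivative `1 /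
√N` is `y / N`, which is `2 * y` times the normalization in `lap`. The right-hand side has the same
form, so the formula iterates. -/
lemma hasDerivAt_fieldAvg {n : ℕ} (β : ℝ) (f : (Fin n → Config N) → ℝ) (y : ℝ) :
    HasDerivAt (fieldAvg N β f) (2 * y * fieldAvg N β (lap f) y) y := by
  have := hasDerivAt_gavg (v := fun y => skVec N β (y / √(N : ℝ)))
    (v' := fun _ => skVec N 0 (1 / √(N : ℝ))) (fun y i σ => hasDerivAt_skVec β y i σ)
    (fun _ => abs_skVec_zero_le _) f y
  convert! this using 1
  rw [fieldAvg, ← gavg_mul_left]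
  congr 1; ext τ
  rw [Fintype.sum_sum_type]
  have h1 : ∀ p : Couple N, conn (skVec N β (y / √(N : ℝ)) (Sum.inl p))
      (conn (skVec N 0 (1 / √(N : ℝ)) (Sum.inl p)) f) τ = 0 := by
    intro p
    simp [skVec, conn]
  have h2 : ∀ i : Fin N, conn (skVec N β (y / √(N : ℝ)) (Sum.inr i))
      (conn (skVec N 0 (1 / √(N : ℝ)) (Sum.inr i)) f) τ =
      y * (1 / N) * conn (fun σ => spin σ i) (conn (fun σ => spin σ i) f) τ := by
    intro i
    rw [← inv_sqrt_mul_self]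
    simp only [skVec, Sum.elim_inr, conn, ← Finset.mul_sum]
    ring
  simp only [h1, h2, Finset.sum_const_zero, zero_add, ← Finset.mul_sum, lap]
  ring

/-- The `N` sites cancel against the prefactor; this is the source of all uniformity in the size. -/
lemma abs_lap_le {n : ℕ} {f : (Fin n → Config N) → ℝ} {A : ℝ} (hA : ∀ τ, |f τ| ≤ A)
    (τ : Fin (n + 2) → Config N) : |lap f τ| ≤ 2 * n * (n + 1) * A := by
  have h := fun i : Fin N => abs_conn_le (abs_conn_le hA fun σ => (abs_spin σ i).le)
    (fun σ => (abs_spin σ i).le) τ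
  have hA0 : 0 ≤ A := (abs_nonneg _).trans (hA (Fin.init (Fin.init τ)))
  rcases Nat.eq_zero_or_pos N with rfl | hN
  · simp only [lap, Finset.univ_eq_empty, Finset.sum_empty, mul_zero, abs_zero]
    positivity
  · have hN' : (0 : ℝ) < N := by positivity
    rw [lap, abs_mul, abs_of_pos (by positivity)]
    have h2 := (Finset.abs_sum_le_sum_abs (fun i : Fin N => conn (fun σ => spin σ i)
      (conn (fun σ => spin σ i) f) τ) Finset.univ).trans
        (Finset.sum_le_card_nsmul Finset.univ _ _ fun i _ => h i)
    simp only [Finset.card_univ, Fintype.card_fin, nsmul_eq_mul] at h2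
    refine (mul_le_mul_of_nonneg_left h2 (by positivity)).trans (le_of_eq ?_)
    push_cast
    field_simp

lemma sum_sq_sum_spin {n : ℕ} (τ : Fin n → Config N) :
    ∑ i, (∑ a, spin (τ a) i) ^ 2 = N * ∑ a, ∑ b, overlap (τ a) (τ b) := by
  simp only [sq, Finset.sum_mul_sum]
  simp only [Finset.mul_sum, ← sum_spin_mul]
  rw [Finset.sum_comm]
  refine Finset.sum_congr rfl fun a _ => ?_
  rw [Finset.sum_comm]

lemma gavg_lap (hN : 0 < N) {n : ℕ} (β : ℝ) (f : (Fin n → Config N) → ℝ) :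
    gavg (skVec N β 0) (lap f) =
      gavg (skVec N β 0) fun τ => f τ * ((∑ a, ∑ b, overlap (τ a) (τ b) - n) / 2) := by
  have hN' : (N : ℝ) ≠ 0 := by positivity
  have h : ∀ ω, rep (energy (skVec N β 0) ω) (lap f) = rep (energy (skVec N β 0) ω)
      fun τ => f τ * ((∑ a, ∑ b, overlap (τ a) (τ b) - n) / 2) := by
    intro ω
    unfold lap
    rw [rep_mul_left, rep_sum]
    have h1 : ∀ i : Fin N, rep (energy (skVec N β 0) ω)
        (conn (fun σ => spin σ i) (conn (fun σ => spin σ i) f)) = _ := fun i =>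
      rep_conn_conn (sum_odd_mul_gw β ω (φ := fun σ => spin σ i) fun σ => spin_neg σ i)
      (fun σ => spin_mul_self σ i) f
    simp only [h1]
    rw [← rep_sum, ← rep_mul_left]
    congr 1; ext τ
    rw [← Finset.mul_sum, Finset.sum_sub_distrib, sum_sq_sum_spin]
    simp only [Finset.sum_const, Finset.card_univ, Fintype.card_fin, nsmul_eq_mul]
    field_simp
  simp only [gavg, h]

lemma gavg_q_zero (β : ℝ) : gavg (skVec N β 0) (q (0 : Fin 2) 1) = 0 := by
  refine gavg_odd β 0 fun τ => ?_
  simp [q_eq_overlap, overlap_neg_left]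

lemma gavg_lap_q (hN : 0 < N) (β : ℝ) :
    gavg (skVec N β 0) (lap (q (0 : Fin 2) 1)) =
      gavg (skVec N β 0) fun τ : Fin 2 → Config N => q 0 1 τ ^ 2 := by
  rw [gavg_lap hN]
  congr 1; ext τ
  simp only [Fin.sum_univ_two, overlap_self hN, q_eq_overlap, overlap_comm (τ 1) (τ 0)]
  push_cast
  ring

lemma lap_q (hN : 0 < N) (τ : Fin 4 → Config N) :
    lap (q (0 : Fin 2) 1) τ = q 0 1 τ * (q 0 1 τ - 1 / 2 * q 0 2 τ - 3 / 2 * q 0 3 τ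
      - 1 / 2 * q 1 2 τ - 3 / 2 * q 1 3 τ + 3 * q 2 3 τ) := by
  have hN' : (N : ℝ) ≠ 0 := by positivity
  have e : ∀ i : Fin N, conn (fun σ => spin σ i) (conn (fun σ => spin σ i) (q (0 : Fin 2) 1)) τ =
      q 0 1 τ * (2 * (spin (τ 0) i * spin (τ 1) i) - spin (τ 0) i * spin (τ 2) i
        - 3 * (spin (τ 0) i * spin (τ 3) i) - spin (τ 1) i * spin (τ 2) i
        - 3 * (spin (τ 1) i * spin (τ 3) i) + 6 * (spin (τ 2) i * spin (τ 3) i)) := by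
    intro i
    have h0 := spin_mul_self (τ 0) i
    have h1 := spin_mul_self (τ 1) i
    have h2 := spin_mul_self (τ 2) i
    have c0 : (Fin.castSucc (Fin.castSucc (0 : Fin 2)) : Fin 4) = 0 := rfl
    have c1 : (Fin.castSucc (Fin.castSucc (1 : Fin 2)) : Fin 4) = 1 := rfl
    have c2 : (Fin.castSucc (Fin.last 2) : Fin 4) = 2 := rfl
    have c3 : (Fin.last 3 : Fin 4) = 3 := rfl
    have d0 : (Fin.castSucc (0 : Fin 3) : Fin 4) = 0 := rfl
    have d1 : (Fin.castSucc (1 : Fin 3) : Fin 4) = 1 := rfl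
    have d2 : (Fin.castSucc (2 : Fin 3) : Fin 4) = 2 := rfl
    have hs : ∀ g : Fin (2 + 1) → ℝ, ∑ x, g x = g 0 + g 1 + g 2 := Fin.sum_univ_three
    simp only [conn, Fin.init, Fin.sum_univ_two, hs, q_eq_overlap, c0, c1, c2, c3,
      d0, d1, d2]
    push_cast
    -- The squares in `(s₀ + s₁ - 2 s₂)(s₀ + s₁ + s₂ - 3 s₃)` cancel, since `1 + 1 - 2 = 0`.
    linear_combination overlap (τ 0) (τ 1) * (h0 + h1 - 2 * h2)
  simp only [lap, e]
  rw [← Finset.mul_sum]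
  simp only [Finset.sum_add_distrib, Finset.sum_sub_distrib, ← Finset.mul_sum, sum_spin_mul,
    q_eq_overlap]
  field_simp
  ring

/-- The endpoints of the six edges of the complete graph on four replicas. -/
def edge : Fin 6 → Fin 4 × Fin 4 := ![(0, 1), (0, 2), (0, 3), (1, 2), (1, 3), (2, 3)]

/-- A product of overlaps averages to zero unless every replica occurs an even number of times.
Together with the edge `{0, 1}`, two further edges achieve this only by closing a triangle. -/
lemma gavg_three_edges (β : ℝ) (k l : Fin 6)
    (h : ¬((k = 1 ∧ l = 3) ∨ (k = 3 ∧ l = 1) ∨ (k = 2 ∧ l = 4) ∨ (k = 4 ∧ l = 2))) :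
    gavg (skVec N β 0) (fun τ : Fin 4 → Config N =>
      q 0 1 τ * q (edge k).1 (edge k).2 τ * q (edge l).1 (edge l).2 τ) = 0 := by
  have key : ∀ k l : Fin 6,
      ¬((k = 1 ∧ l = 3) ∨ (k = 3 ∧ l = 1) ∨ (k = 2 ∧ l = 4) ∨ (k = 4 ∧ l = 2)) →
      ∃ r : Fin 4, (if 0 = r ∨ 1 = r then (-1 : ℤ) else 1) *
        (if (edge k).1 = r ∨ (edge k).2 = r then -1 else 1) *
        (if (edge l).1 = r ∨ (edge l).2 = r then -1 else 1) = -1 := by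
    decide
  obtain ⟨r, hr⟩ := key k l h
  refine gavg_odd β r fun τ => ?_
  have hq : ∀ a b : Fin 4, a ≠ b → q a b (Function.update τ r (-τ r)) =
      (((if a = r ∨ b = r then (-1 : ℤ) else 1) : ℤ) : ℝ) * q a b τ := by
    intro a b hab
    simp only [q_eq_overlap]
    by_cases ha : a = r
    · subst ha
      rw [Function.update_self, Function.update_of_ne hab.symm, overlap_neg_left]
      simp
    · by_cases hb : b = r
      · subst hb
        rw [Function.update_self, Function.update_of_ne hab, overlap_neg_right]
        simp
      · rw [Function.update_of_ne ha, Function.update_of_ne hb]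
        simp [ha, hb]
  have hne : ∀ k : Fin 6, (edge k).1 ≠ (edge k).2 := by decide
  rw [hq 0 1 (by decide), hq _ _ (hne k), hq _ _ (hne l)]
  have hr' := congrArg (Int.cast (R := ℝ)) hr
  rw [Int.cast_mul, Int.cast_mul] at hr'
  push_cast at hr' ⊢
  linear_combination (q 0 1 τ * q (edge k).1 (edge k).2 τ * q (edge l).1 (edge l).2 τ) * hr'

lemma gavg_lap_lap_q (hN : 0 < N) (β : ℝ) :
    gavg (skVec N β 0) (lap (lap (q (0 : Fin 2) 1))) =
      -4 * gavg (skVec N β 0) fun τ : Fin 3 → Config N => q 0 1 τ * q 1 2 τ * q 0 2 τ := by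
  set M : Fin 6 → Fin 6 → ℝ := fun k l => gavg (skVec N β 0) fun τ : Fin 4 → Config N =>
      q 0 1 τ * q (edge k).1 (edge k).2 τ * q (edge l).1 (edge l).2 τ with hM
  set T := gavg (skVec N β 0) fun τ : Fin 3 → Config N => q 0 1 τ * q 1 2 τ * q 0 2 τ
  have h13 : M 1 3 = T := by
    refine Eq.trans ?_ (gavg_init _ _)
    simp only [hM]
    congr 1; ext τ
    simp only [edge, q_eq_overlap, Fin.init]
    change overlap (τ 0) (τ 1) * overlap (τ 0) (τ 2) * overlap (τ 1) (τ 2) =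
      overlap (τ 0) (τ 1) * overlap (τ 1) (τ 2) * overlap (τ 0) (τ 2)
    ring
  have h24 : M 2 4 = T := by
    rw [← h13]
    simp only [hM]
    rw [← gavg_perm _ (Equiv.swap 2 3)]
    congr 1
  have h31 : M 3 1 = T := by
    rw [← h13]; simp only [hM]; congr 1; ext τ; ring
  have h42 : M 4 2 = T := by
    rw [← h24]; simp only [hM]; congr 1; ext τ; ring
  have hz : ∀ k l, ¬((k = 1 ∧ l = 3) ∨ (k = 3 ∧ l = 1) ∨ (k = 2 ∧ l = 4) ∨ (k = 4 ∧ l = 2)) →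
      M k l = 0 := gavg_three_edges β
  -- The coefficients of `lap_q`. Edges `1` to `4` each meet exactly one completing edge, so the
  -- total is `-1/2 - 3/2 - 1/2 - 3/2 = -4`.
  set α : Fin 6 → ℝ := ![1, -1 / 2, -3 / 2, -1 / 2, -3 / 2, 3] with hα
  rw [gavg_lap hN]
  have e : ∀ τ : Fin 4 → Config N, lap (q (0 : Fin 2) 1) τ *
      ((∑ a, ∑ b, overlap (τ a) (τ b) - (4 : ℕ)) / 2) = ∑ k, ∑ l, α k *
        (q 0 1 τ * q (edge k).1 (edge k).2 τ * q (edge l).1 (edge l).2 τ) := by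
    intro τ
    rw [lap_q hN]
    simp only [Fin.sum_univ_four, Fin.sum_univ_six, edge, hα, q_eq_overlap, overlap_self hN,
      overlap_comm (τ 1) (τ 0), overlap_comm (τ 2) (τ 0), overlap_comm (τ 3) (τ 0),
      overlap_comm (τ 2) (τ 1), overlap_comm (τ 3) (τ 1), overlap_comm (τ 3) (τ 2)]
    simp
    ring
  have e2 : gavg (skVec N β 0) (fun τ : Fin 4 → Config N => lap (q (0 : Fin 2) 1) τ *
      ((∑ a, ∑ b, overlap (τ a) (τ b) - (4 : ℕ)) / 2)) = ∑ k, ∑ l, α k * M k l := by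
    simp only [e]
    rw [gavg_sum]
    refine Finset.sum_congr rfl fun k _ => ?_
    rw [gavg_sum]
    exact Finset.sum_congr rfl fun l _ => gavg_mul_left _ _ _
  have e3 : ∀ k l, M k l = if ((k = 1 ∧ l = 3) ∨ (k = 3 ∧ l = 1) ∨ (k = 2 ∧ l = 4) ∨
      (k = 4 ∧ l = 2)) then T else 0 := by
    intro k l
    split_ifs with h
    · rcases h with ⟨rfl, rfl⟩ | ⟨rfl, rfl⟩ | ⟨rfl, rfl⟩ | ⟨rfl, rfl⟩ <;> assumption
    · exact hz k l h
  refine e2.trans ?_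
  simp only [e3, Fin.sum_univ_six, hα]
  simp
  ring

end Field

/-! ### Taylor expansion in the square of the field. -/

section Taylor

/-- In the variable `t = y ^ 2` the hypothesis reads `dF/dt = H` with `|H| ≤ c * t ^ k`, and the
bound is its integral. -/
lemma abs_sub_le_of_hasDerivAt {F H : ℝ → ℝ} {c : ℝ} {k : ℕ}
    (hF : ∀ y, HasDerivAt F (2 * y * H y) y) (hH : ∀ y, 0 ≤ y → |H y| ≤ c * y ^ (2 * k))
    {y : ℝ} (hy : 0 ≤ y) : |F y - F 0| ≤ c / (k + 1) * y ^ (2 * k + 2) := by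
  have hk : (k : ℝ) + 1 ≠ 0 := by positivity
  have hp : ∀ x : ℝ, HasDerivAt (fun x : ℝ => c / (k + 1) * x ^ (2 * k + 2))
      (2 * x * (c * x ^ (2 * k))) x := by
    intro x
    convert! (hasDerivAt_pow (2 * k + 2) x).const_mul (c / (k + 1)) using 1
    rw [show 2 * k + 2 - 1 = 2 * k + 1 by omega]
    push_cast
    field_simp
    ring
  have m1 : MonotoneOn (fun x => F x + c / (k + 1) * x ^ (2 * k + 2)) (Set.Ici 0) := by
    refine monotoneOn_of_deriv_nonneg (convex_Ici _)
      (fun x _ => ((hF x).fun_add (hp x)).continuousAt.continuousWithinAt)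
      (fun x _ => ((hF x).fun_add (hp x)).differentiableAt.differentiableWithinAt) fun x hx => ?_
    rw [interior_Ici] at hx
    rw [((hF x).fun_add (hp x)).deriv, ← mul_add]
    have := (abs_le.1 (hH x (le_of_lt hx))).1
    exact mul_nonneg (by linarith [Set.mem_Ioi.1 hx]) (by linarith)
  have m2 : MonotoneOn (fun x => c / (k + 1) * x ^ (2 * k + 2) - F x) (Set.Ici 0) := by
    refine monotoneOn_of_deriv_nonneg (convex_Ici _)
      (fun x _ => ((hp x).fun_sub (hF x)).continuousAt.continuousWithinAt)
      (fun x _ => ((hp x).fun_sub (hF x)).differentiableAt.differentiableWithinAt) fun x hx => ?_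
    rw [interior_Ici] at hx
    rw [((hp x).fun_sub (hF x)).deriv, ← mul_sub]
    have := (abs_le.1 (hH x (le_of_lt hx))).2
    exact mul_nonneg (by linarith [Set.mem_Ioi.1 hx]) (by linarith)
  have a1 := m1 Set.self_mem_Ici hy hy
  have a2 := m2 Set.self_mem_Ici hy hy
  simp only [ne_eq, Nat.add_eq_zero_iff, mul_eq_zero, OfNat.ofNat_ne_zero, false_or, and_false,
    not_false_eq_true, zero_pow, mul_zero, add_zero, zero_sub] at a1 a2
  rw [abs_le]
  constructor <;> linarith

lemma abs_taylor_le {G₀ G₁ G₂ G₃ : ℝ → ℝ} {C : ℝ} (h₀ : ∀ y, HasDerivAt G₀ (2 * y * G₁ y) y)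
    (h₁ : ∀ y, HasDerivAt G₁ (2 * y * G₂ y) y) (h₂ : ∀ y, HasDerivAt G₂ (2 * y * G₃ y) y)
    (h₃ : ∀ y, |G₃ y| ≤ C) {y : ℝ} (hy : 0 ≤ y) :
    |G₀ y - G₀ 0 - G₁ 0 * y ^ 2 - G₂ 0 / 2 * y ^ 4| ≤ C / 6 * y ^ 6 := by
  have s2 : ∀ y, 0 ≤ y → |G₂ y - G₂ 0| ≤ C * y ^ (2 * 1) := fun y hy => by
    have := abs_sub_le_of_hasDerivAt (k := 0) h₂ (fun y _ => by simpa using h₃ y) hy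
    simpa using this
  have s1 : ∀ y, 0 ≤ y → |G₁ y - G₁ 0 - G₂ 0 * y ^ 2| ≤ C / 2 * y ^ (2 * 2) := fun y hy => by
    have := abs_sub_le_of_hasDerivAt (k := 1) (F := fun y => G₁ y - G₂ 0 * y ^ 2)
      (H := fun y => G₂ y - G₂ 0) (fun y => by
        convert! (h₁ y).sub ((hasDerivAt_pow 2 y).const_mul (G₂ 0)) using 1
        push_cast
        ring) s2 hy
    norm_num at this ⊢
    convert this using 2
    ring
  have := abs_sub_le_of_hasDerivAt (k := 2)
    (F := fun y => G₀ y - G₁ 0 * y ^ 2 - G₂ 0 / 2 * y ^ 4)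
    (H := fun y => G₁ y - G₁ 0 - G₂ 0 * y ^ 2) (fun y => by
      convert! ((h₀ y).sub ((hasDerivAt_pow 2 y).const_mul (G₁ 0))).sub
        ((hasDerivAt_pow 4 y).const_mul (G₂ 0 / 2)) using 1
      push_cast
      ring) s1 hy
  norm_num at this
  convert this using 2
  · ring
  · ring

end Taylor

lemma abs_q_le {N n : ℕ} (a b : Fin n) (τ : Fin n → Config N) : |q a b τ| ≤ 1 :=
  abs_overlap_le _ _

lemma q_eq_zero {n : ℕ} (a b : Fin n) (τ : Fin n → Config 0) : q a b τ = 0 := by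
  simp [q]

/-- The expansion of the average overlap in powers of the field, uniformly in the size. -/
theorem abs_average_expansion_le (N : ℕ) (β y : ℝ) :
    |average N β (y ^ 2 / (N : ℝ)) (q (0 : Fin 2) 1) -
        (average N β 0 (fun τ : Fin 2 → Config N => q 0 1 τ ^ 2) * y ^ 2 -
          2 * average N β 0
            (fun τ : Fin 3 → Config N => q 0 1 τ * q 1 2 τ * q 0 2 τ) * y ^ 4)|
        ≤ 6720 * y ^ 6 := by
  rcases Nat.eq_zero_or_pos N with rfl | hN
  · have e : (q (0 : Fin 2) 1 : (Fin 2 → Config 0) → ℝ) = fun _ => 0 := by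
      ext τ; exact q_eq_zero _ _ _
    simp only [average_eq_gavg, e]
    simp only [q_eq_zero]
    simp only [ne_eq, OfNat.ofNat_ne_zero, not_false_eq_true, zero_pow, mul_zero, gavg_const]
    simp
    positivity
  -- Three applications of `lap`, to functions of 2, 4 and 6 replicas, cost `12 * 40 * 84 = 40320`;
  -- division by `3!` gives `6720`.
  · have := abs_taylor_le (G₀ := fieldAvg N β (q (0 : Fin 2) 1)) (C := 40320)
      (hasDerivAt_fieldAvg β _) (hasDerivAt_fieldAvg β _) (hasDerivAt_fieldAvg β _)
      (fun y => abs_gavg_le _ fun τ => (abs_lap_le (fun τ => abs_lap_le (fun τ =>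
        abs_lap_le (abs_q_le _ _) τ) τ) τ).trans (by norm_num)) (abs_nonneg y)
    rw [fieldAvg_zero, fieldAvg_zero, fieldAvg_zero, gavg_q_zero, gavg_lap_q hN,
      gavg_lap_lap_q hN] at this
    rw [average_eq_fieldAvg, average_zero_eq, average_zero_eq]
    have e2 : |y| ^ 2 = y ^ 2 := sq_abs y
    have e4 : |y| ^ 4 = y ^ 4 := by rw [show 4 = 2 * 2 by rfl, pow_mul, pow_mul, sq_abs]
    have e6 : |y| ^ 6 = y ^ 6 := by rw [show 6 = 2 * 3 by rfl, pow_mul, pow_mul, sq_abs]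
    rw [e2, e4, e6] at this
    convert this using 2
    · ring
    · norm_num

/-! ### Convexity and factorization of the log-partition function. -/

section General

variable {S T I J : Type*} [Fintype S] [Fintype T] [Fintype I] [Fintype J] [Nonempty S] [Nonempty T]

/-- The logarithm of the partition function lies above its tangents. -/
lemma log_sum_exp_tangent (E E' : S → ℝ) :
    Real.log (∑ s, Real.exp (E s)) + rep E (fun τ : Fin 1 → S => E' (τ 0) - E (τ 0)) ≤
      Real.log (∑ s, Real.exp (E' s)) := by
  have h1 := rep_prod E (fun _ : Fin 1 => fun s => E' s - E s)
  simp only [Fin.prod_univ_one, Fin.isValue] at h1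
  have h2 := convexOn_exp.map_sum_le (t := Finset.univ) (w := gw E) (p := fun s => E' s - E s)
    (fun s _ => gw_nonneg E s) (sum_gw E) (fun _ _ => Set.mem_univ _)
  simp only [smul_eq_mul] at h2
  have h3 : ∑ s, gw E s * Real.exp (E' s - E s) =
      (∑ s, Real.exp (E' s)) / ∑ s, Real.exp (E s) := by
    rw [Finset.sum_div]
    refine Finset.sum_congr rfl fun s _ => ?_
    rw [gw, Real.exp_sub]
    field_simp
  rw [h3] at h2
  have h4 := Real.log_le_log (Real.exp_pos _) h2
  rw [Real.log_exp, Real.log_div (sum_exp_pos E').ne' (sum_exp_pos E).ne'] at h4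
  rw [h1]
  simp only [mul_comm (gw E _)] at h4
  linarith

lemma integrable_rep_energy (v v' : I → S → ℝ) :
    Integrable (fun ω => rep (energy v ω) (fun τ : Fin 1 → S => energy v' ω (τ 0)))
      (stdGauss I) := by
  unfold energy
  simp only [rep_sum, rep_mul_left]
  refine integrable_finsetSum _ fun i _ => ?_
  obtain ⟨A, _, hA⟩ := exists_bound (fun τ : Fin 1 → S => v' i (τ 0))
  exact integrable_coord_mul i (continuous_rep_energy v _) fun ω => abs_rep_le _ hA

/-- The log-partition function is convex in the exponents. The slope along the dilation of `v` is
the mean energy, which integration by parts turns into a covariance increment. -/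
lemma logPart_tangent (v : I → S → ℝ) (c : ℝ) :
    logPart v + c * gavg v (fun τ : Fin 2 → S => cov v (τ 0) (τ 0) - cov v (τ 0) (τ 1)) ≤
      logPart (fun i s => (1 + c) * v i s) := by
  have h := integral_rep_energy v v
  have e : (fun τ : Fin 2 → S => ∑ i, v i (τ 0) * (v i (τ 0) - v i (τ 1))) =
      fun τ => cov v (τ 0) (τ 0) - cov v (τ 0) (τ 1) := by
    ext τ; simp [cov, mul_sub, Finset.sum_sub_distrib]
  rw [e] at h
  rw [← h, ← integral_const_mul, logPart, logPart,
    ← integral_add (integrable_log_part v) ((integrable_rep_energy v v).const_mul c)]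
  refine integral_mono ((integrable_log_part v).add ((integrable_rep_energy v v).const_mul c))
    (integrable_log_part _) fun ω => ?_
  have := log_sum_exp_tangent (energy v ω) (energy (fun i s => (1 + c) * v i s) ω)
  refine le_trans (le_of_eq ?_) this
  simp only
  rw [← rep_mul_left]
  congr 2; ext τ
  simp only [energy, Finset.mul_sum, ← Finset.sum_sub_distrib]
  exact Finset.sum_congr rfl fun i _ => by ring

lemma logPart_prod (v : I → S → ℝ) (v' : J → T → ℝ) :
    logPart (Sum.elim (fun i (p : S × T) => v i p.1) (fun j p => v' j p.2)) =
      logPart v + logPart v' := by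
  have m1 := measurePreserving_inl (I := I) (J := J)
  have m2 := measurePreserving_inr (I := I) (J := J)
  have i1 := (m1.integrable_comp (integrable_log_part v).1).2 (integrable_log_part v)
  have i2 := (m2.integrable_comp (integrable_log_part v').1).2 (integrable_log_part v')
  have e1 : logPart v = ∫ ω : I ⊕ J → ℝ,
      Real.log (∑ s, Real.exp (energy v (ω ∘ Sum.inl) s)) ∂stdGauss (I ⊕ J) := by
    rw [logPart, ← m1.map_eq, integral_map m1.measurable.aemeasurable]
    rw [m1.map_eq]; exact (integrable_log_part v).1
  have e2 : logPart v' = ∫ ω : I ⊕ J → ℝ,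
      Real.log (∑ s, Real.exp (energy v' (ω ∘ Sum.inr) s)) ∂stdGauss (I ⊕ J) := by
    rw [logPart, ← m2.map_eq, integral_map m2.measurable.aemeasurable]
    rw [m2.map_eq]; exact (integrable_log_part v').1
  refine Eq.trans ?_ ((integral_add i1 i2).trans (by rw [e1, e2]; rfl))
  rw [logPart]
  congr 1; ext ω
  simp only [Function.comp_apply]
  rw [← Real.log_mul (sum_exp_pos _).ne' (sum_exp_pos _).ne', Finset.sum_mul_sum,
    ← Fintype.sum_prod_type']
  simp [energy, Fintype.sum_sum_type, Real.exp_add]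

lemma logPart_zero (I : Type*) [Fintype I] :
    logPart (fun (_ : I) (_ : S) => 0) = Real.log (Fintype.card S) := by
  simp [logPart, energy]

lemma logPart_empty_prod (v : I → S → ℝ) :
    logPart (fun i (p : S × T) => v i p.1) = logPart v + Real.log (Fintype.card T) := by
  rw [← logPart_zero (S := T) Empty, ← logPart_prod]
  refine (logPart_congr_cov _ _ fun s s' => ?_)
  simp [cov, Fintype.sum_sum_type]

end General

/-! ### The zero-field pressure: convexity, superadditivity, Guerra's bound. -/

section SKPressure

variable {N M : ℕ}

/-- The quenched logarithm of the zero-field partition function. -/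
def pressure (N : ℕ) (β : ℝ) : ℝ := logPart (skVec N β 0)

/-- The mean square overlap without field. -/
def meanSq (N : ℕ) (β : ℝ) : ℝ := gavg (skVec N β 0) fun τ : Fin 2 → Config N => q 0 1 τ ^ 2

lemma meanSq_nonneg (β : ℝ) : 0 ≤ meanSq N β := by
  rw [← gavg_const (n := 2) (skVec N β 0) 0]
  exact gavg_mono _ fun τ => sq_nonneg _

lemma cov_skVec_sub (hN : 0 < N) (β r : ℝ) (σ σ' : Config N) :
    cov (skVec N β r) σ σ - cov (skVec N β r) σ σ' =
      β ^ 2 / 2 * N * (1 - overlap σ σ' ^ 2) + r ^ 2 * N * (1 - overlap σ σ') := by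
  simp only [cov_skVec, overlap_self hN]; ring

/-- Changing `β` dilates the exponents. This convexity inequality, used in both directions, lets
limits of the pressure control `meanSq`. -/
lemma pressure_tangent (hN : 0 < N) {β : ℝ} (hβ : 0 < β) (β' : ℝ) :
    pressure N β + (β' - β) * (N * β / 2 * (1 - meanSq N β)) ≤ pressure N β' := by
  have h := logPart_tangent (skVec N β 0) ((β' - β) / β)
  have e1 : (fun i σ => (1 + (β' - β) / β) * skVec N β 0 i σ) = skVec N β' 0 := by
    ext i σ
    rcases i with p | i
    · simp only [skVec, Sum.elim_inl]; field_simp; ring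
    · simp [skVec]
  have e2 : gavg (skVec N β 0) (fun τ : Fin 2 → Config N =>
      cov (skVec N β 0) (τ 0) (τ 0) - cov (skVec N β 0) (τ 0) (τ 1)) =
      β ^ 2 / 2 * N * (1 - meanSq N β) := by
    simp only [cov_skVec_sub hN]
    have h1 := gavg_const (n := 2) (skVec N β 0) 1
    rw [meanSq, ← h1, ← gavg_sub, ← gavg_mul_left]
    congr 1; ext τ
    simp only [h1, q_eq_overlap]
    ring
  rw [e1, e2] at h
  refine le_trans (le_of_eq ?_) h
  rw [pressure]
  field_simp

/-- The Guerra-Toninelli argument: the total overlap is the weighted mean of the overlaps of the two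
blocks, so convexity of the square orders the covariance increments. -/
lemma pressure_superadditive (hN : 0 < N) (hM : 0 < M) (β : ℝ) :
    pressure N β + pressure M β ≤ pressure (N + M) β := by
  have h1 := logPart_prod (skVec N β 0) (skVec M β 0)
  rw [← logPart_equiv (Fin.appendEquiv N M (α := ℤˣ)).symm] at h1
  rw [pressure, pressure, ← h1, pressure]
  refine (logPart_le_of_cov _ (skVec (N + M) β 0) 0 fun σ σ' => ?_).trans (by simp)
  set σ₁ : Config N := fun i => σ (Fin.castAdd M i) with hσ₁
  set σ₂ : Config M := fun i => σ (Fin.natAdd N i) with hσ₂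
  set ρ₁ : Config N := fun i => σ' (Fin.castAdd M i) with hρ₁
  set ρ₂ : Config M := fun i => σ' (Fin.natAdd N i) with hρ₂
  have hc : ∀ σ σ' : Config (N + M), cov (fun i t => (Sum.elim
      (fun i (p : Config N × Config M) => skVec N β 0 i p.1) (fun j p => skVec M β 0 j p.2)) i
        ((Fin.appendEquiv N M (α := ℤˣ)).symm t)) σ σ' =
      cov (skVec N β 0) (fun i => σ (Fin.castAdd M i)) (fun i => σ' (Fin.castAdd M i)) +
      cov (skVec M β 0) (fun i => σ (Fin.natAdd N i)) (fun i => σ' (Fin.natAdd N i)) := by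
    intro σ σ'
    simp only [cov, Fintype.sum_sum_type (α₁ := Couple N ⊕ Fin N), Sum.elim_inl, Sum.elim_inr]
    rfl
  rw [hc, hc, add_sub_add_comm, cov_skVec_sub hN, cov_skVec_sub hM, cov_skVec_sub (by omega)]
  have ho : ((N + M : ℕ) : ℝ) * overlap σ σ' = N * overlap σ₁ ρ₁ + M * overlap σ₂ ρ₂ := by
    rw [← sum_spin_mul, ← sum_spin_mul, ← sum_spin_mul, Fin.sum_univ_add]
    rfl
  have hN' : (0 : ℝ) < N := by positivity
  have hM' : (0 : ℝ) < M := by positivity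
  set o := overlap σ σ'
  set o₁ := overlap σ₁ ρ₁
  set o₂ := overlap σ₂ ρ₂
  push_cast at ho ⊢
  have key : (N + M : ℝ) * o ^ 2 ≤ N * o₁ ^ 2 + M * o₂ ^ 2 := by
    have h3 : (N + M : ℝ) * ((N + M : ℝ) * o ^ 2) ≤ (N + M) * (N * o₁ ^ 2 + M * o₂ ^ 2) := by
      have : (N + M : ℝ) * ((N + M : ℝ) * o ^ 2) = (N * o₁ + M * o₂) ^ 2 := by rw [← ho]; ring
      rw [this]
      nlinarith [mul_nonneg (mul_pos hN' hM').le (sq_nonneg (o₁ - o₂))]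
    exact le_of_mul_le_mul_left h3 (by positivity)
  nlinarith [mul_le_mul_of_nonneg_left key (by positivity : 0 ≤ β ^ 2 / 2)]

lemma pressure_zero_size (β : ℝ) : pressure 0 β = 0 := by
  have : skVec 0 β 0 = fun _ _ => 0 := by
    ext i σ
    rcases i with p | i
    · exact p.1.1.elim0
    · exact i.elim0
  rw [pressure, this, logPart_zero]
  simp

lemma pressure_superadditive' (N M : ℕ) (β : ℝ) :
    pressure N β + pressure M β ≤ pressure (N + M) β := by
  rcases Nat.eq_zero_or_pos N with rfl | hN
  · simp [pressure_zero_size]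
  rcases Nat.eq_zero_or_pos M with rfl | hM
  · simp [pressure_zero_size]
  exact pressure_superadditive hN hM β

lemma log_card_config : Real.log (Fintype.card (Config N)) = N * Real.log 2 := by
  simp

/-- Guerra's replica-symmetric bound, in terms of a system of independent spins. -/
lemma pressure_le_field (hN : 0 < N) (β q₀ r : ℝ) (hr : r ^ 2 = β ^ 2 * q₀) :
    pressure N β ≤ logPart (skVec N 0 r) + N * (β ^ 2 / 4 * (1 - q₀) ^ 2) := by
  -- The defect in the comparison is the nonnegative term `N * β ^ 2 / 2 * (overlap - q₀) ^ 2`.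
  have := logPart_le_of_cov (skVec N β 0) (skVec N 0 r) (N * (β ^ 2 / 2 * (1 - q₀) ^ 2))
    fun σ σ' => by
      rw [cov_skVec_sub hN, cov_skVec_sub hN, hr]
      nlinarith [mul_nonneg (mul_nonneg (Nat.cast_nonneg (α := ℝ) N) (sq_nonneg β))
        (sq_nonneg (overlap σ σ' - q₀))]
  rw [pressure]
  linarith

lemma pressure_le (N : ℕ) (β : ℝ) : pressure N β ≤ N * (Real.log 2 + β ^ 2 / 4) := by
  rcases Nat.eq_zero_or_pos N with rfl | hN
  · simp [pressure_zero_size]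
  have h := pressure_le_field hN β 0 0 (by simp)
  have : skVec N 0 0 = fun _ _ => 0 := by
    ext i σ
    rcases i with p | i <;> simp [skVec]
  rw [this, logPart_zero, log_card_config] at h
  linarith

lemma pressure_temperature_le (hN : 0 < N) {β β' : ℝ} (h : β ^ 2 ≤ β' ^ 2) :
    pressure N β' ≤ pressure N β + N * (β' ^ 2 - β ^ 2) / 4 := by
  have := logPart_le_of_cov (skVec N β' 0) (skVec N β 0) (N * (β' ^ 2 - β ^ 2) / 2)
    fun σ σ' => by
      rw [cov_skVec_sub hN, cov_skVec_sub hN]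
      nlinarith [mul_nonneg (mul_nonneg (Nat.cast_nonneg (α := ℝ) N) (sub_nonneg.2 h))
        (sq_nonneg (overlap σ σ'))]
  rw [pressure, pressure]
  linarith

/-- The thermodynamic limit of the pressure per site. -/
lemma tendsto_pressure (β : ℝ) :
    ∃ F : ℝ, Tendsto (fun N : ℕ => pressure N β / N) atTop (𝓝 F) := by
  have hs : Subadditive fun N => -pressure N β := fun m n => by
    have := pressure_superadditive' m n β
    linarith
  have hb : BddBelow (Set.range fun N : ℕ => -pressure N β / N) := by
    refine ⟨-(Real.log 2 + β ^ 2 / 4), ?_⟩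
    rintro _ ⟨N, rfl⟩
    simp only
    rcases Nat.eq_zero_or_pos N with rfl | hN
    · simp only [Nat.cast_zero, div_zero, Left.neg_nonpos_iff]
      have := Real.log_nonneg (one_le_two (α := ℝ))
      positivity
    · have hN' : (0 : ℝ) < N := by positivity
      rw [neg_div, neg_le_neg_iff, div_le_iff₀ hN', mul_comm]
      exact pressure_le N β
  refine ⟨-hs.lim, ?_⟩
  have := (hs.tendsto_lim hb).neg
  simpa [neg_div] using this

end SKPressure

/-! ### Adding one spin. -/

section Cavity

variable {N : ℕ}

/-- The configuration of the first `N` spins, relative to the last one. -/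
def gauge (N : ℕ) : Config (N + 1) ≃ Config N × ℤˣ where
  toFun σ := (fun i => σ i.castSucc * σ (Fin.last N), σ (Fin.last N))
  invFun p := Fin.snoc (α := fun _ => ℤˣ) (fun i => p.1 i * p.2) p.2
  left_inv σ := by
    ext i
    refine Fin.lastCases ?_ (fun i => ?_) i
    · simp
    · simp [mul_assoc]
  right_inv p := by
    ext i <;> simp [mul_assoc]

/-- Adding one spin amounts to switching on an external field. -/
lemma pressure_succ (hN : 0 < N) (β : ℝ) :
    pressure (N + 1) (β * √((N + 1) / N)) =
      Real.log 2 + logPart (skVec N β (β / √(N : ℝ))) := by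
  have h1 := logPart_empty_prod (T := ℤˣ) (skVec N β (β / √(N : ℝ)))
  rw [← logPart_equiv (gauge N)] at h1
  have hc : Real.log (Fintype.card ℤˣ) = Real.log 2 := by simp
  rw [← hc, add_comm (Real.log _), ← h1, pressure]
  -- The shifted temperature makes the coupling strength `β / √N`, as in the smaller system. After
  -- gauging, the couplings to the last spin act as random fields of that amplitude and the last
  -- spin is free, whence `log 2`.
  refine logPart_congr_cov _ _ fun σ σ' => ?_
  have hcov : ∀ σ σ' : Config (N + 1), cov (fun i (t : Config (N + 1)) =>
      (fun i (p : Config N × ℤˣ) => skVec N β (β / √(N : ℝ)) i p.1) i ((gauge N) t)) σ σ' =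
      cov (skVec N β (β / √(N : ℝ))) (gauge N σ).1 (gauge N σ').1 := fun _ _ => rfl
  rw [hcov, hcov, cov_skVec_sub hN, cov_skVec_sub (Nat.succ_pos N)]
  have hN' : (0 : ℝ) < N := by positivity
  set e := spin σ (Fin.last N) * spin σ' (Fin.last N) with he
  have he2 : e * e = 1 := by
    rw [he, mul_mul_mul_comm, spin_mul_self, spin_mul_self, one_mul]
  have ho : (N : ℝ) * overlap (gauge N σ).1 (gauge N σ').1 =
      e * (((N + 1 : ℕ) : ℝ) * overlap σ σ') - 1 := by
    rw [← sum_spin_mul, ← sum_spin_mul, Fin.sum_univ_castSucc, mul_add, ← he, he2,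
      Finset.mul_sum, add_sub_cancel_right]
    refine Finset.sum_congr rfl fun i _ => ?_
    simp only [gauge, Equiv.coe_fn_mk, spin, he, Units.val_mul, Int.cast_mul]
    ring
  set o := overlap σ σ'
  set o' := overlap (gauge N σ).1 (gauge N σ').1
  have ho' : o' = (e * ((N + 1) * o) - 1) / N := by
    rw [eq_div_iff hN'.ne', mul_comm, ho]; push_cast; ring
  rw [mul_pow, div_pow, Real.sq_sqrt hN'.le, Real.sq_sqrt (by positivity), ho']
  push_cast
  field_simp
  linear_combination (β ^ 2 * (N + 1) ^ 2 * o ^ 2) * he2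

end Cavity

/-! ### Controlling the effect of the field by the zero-field mean square overlap. -/

section FieldPressure

variable {N : ℕ}

/-- The quenched log-partition function in a random field of variance `y² / N`. -/
def fieldPressure (N : ℕ) (β y : ℝ) : ℝ := logPart (skVec N β (y / √(N : ℝ)))

lemma fieldPressure_zero (N : ℕ) (β : ℝ) : fieldPressure N β 0 = pressure N β := by
  simp [fieldPressure, pressure]

lemma hasDerivAt_fieldPressure (hN : 0 < N) (β y : ℝ) :
    HasDerivAt (fieldPressure N β) (y * (1 - fieldAvg N β (q (0 : Fin 2) 1) y)) y := by
  have hN' : (N : ℝ) ≠ 0 := by positivity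
  have := hasDerivAt_logPart (v := fun y => skVec N β (y / √(N : ℝ)))
    (v' := fun _ => skVec N 0 (1 / √(N : ℝ))) (fun y i σ => hasDerivAt_skVec β y i σ)
    (fun _ => abs_skVec_zero_le _) y
  convert! this using 1
  have h1 := gavg_const (n := 2) (skVec N β (y / √(N : ℝ))) 1
  rw [fieldAvg, ← h1, ← gavg_sub, ← gavg_mul_left]
  congr 1; ext τ
  have e1 : ∀ p : Couple N, skVec N 0 (1 / √(N : ℝ)) (Sum.inl p) (τ 0) = 0 := by simp [skVec]
  have e2 : ∀ i : Fin N, skVec N 0 (1 / √(N : ℝ)) (Sum.inr i) (τ 0) *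
      (skVec N β (y / √(N : ℝ)) (Sum.inr i) (τ 0) - skVec N β (y / √(N : ℝ)) (Sum.inr i) (τ 1)) =
      y * (1 / N) * (1 - spin (τ 0) i * spin (τ 1) i) := by
    intro i
    rw [← inv_sqrt_mul_self]
    simp only [skVec, Sum.elim_inr]
    linear_combination y * (1 / √(N : ℝ)) ^ 2 * spin_mul_self (τ 0) i
  rw [Fintype.sum_sum_type]
  simp only [h1, e1, e2, zero_mul, Finset.sum_const_zero, zero_add, ← Finset.mul_sum,
    Finset.sum_sub_distrib, sum_spin_mul, q_eq_overlap]
  simp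
  field_simp

lemma lap_eq_mul {n : ℕ} (f : (Fin n → Config N) → ℝ) (τ : Fin (n + 2) → Config N) :
    lap f τ = f (Fin.init (Fin.init τ)) * lap (fun _ : Fin n → Config N => 1) τ := by
  simp only [lap, conn, Finset.mul_sum]
  exact Finset.sum_congr rfl fun i _ => by ring

/-- `lap` multiplies `f` by a bounded function, so the bound is pointwise in `|f|`, as a Grönwall
argument requires. -/
lemma abs_lap_le_mul {n : ℕ} (f : (Fin n → Config N) → ℝ) (τ : Fin (n + 2) → Config N) :
    |lap f τ| ≤ 2 * n * (n + 1) * |f (Fin.init (Fin.init τ))| := by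
  rw [lap_eq_mul, abs_mul, mul_comm]
  refine mul_le_mul_of_nonneg_right ?_ (abs_nonneg _)
  simpa using abs_lap_le (f := fun _ : Fin n → Config N => 1) (A := 1) (by simp) τ

/-- Grönwall's inequality in `y ^ 2`, with rate `2 * 2 * 3 = 12` for two replicas. -/
lemma fieldAvg_sq_le (β : ℝ) {y : ℝ} (hy : 0 ≤ y) :
    fieldAvg N β (fun τ : Fin 2 → Config N => q 0 1 τ ^ 2) y ≤
      meanSq N β * Real.exp (12 * y ^ 2) := by
  set f : (Fin 2 → Config N) → ℝ := fun τ => q 0 1 τ ^ 2 with hf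
  have hd : ∀ y, HasDerivAt (fun y => fieldAvg N β f y * Real.exp (-(12 * y ^ 2)))
      ((2 * y * (fieldAvg N β (lap f) y - 12 * fieldAvg N β f y)) * Real.exp (-(12 * y ^ 2)))
      y := by
    intro y
    have h1 : HasDerivAt (fun y : ℝ => -(12 * y ^ 2)) (-(24 * y)) y := by
      convert! ((hasDerivAt_pow 2 y).const_mul 12).neg using 1
      push_cast; ring
    convert! (hasDerivAt_fieldAvg β f y).mul h1.exp using 1
    ring
  have hanti : AntitoneOn (fun y => fieldAvg N β f y * Real.exp (-(12 * y ^ 2))) (Set.Ici 0) := by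
    refine antitoneOn_of_deriv_nonpos (convex_Ici _)
      (fun x _ => (hd x).continuousAt.continuousWithinAt)
      (fun x _ => (hd x).differentiableAt.differentiableWithinAt) fun x hx => ?_
    rw [interior_Ici] at hx
    rw [(hd x).deriv]
    have hx' : 0 < x := hx
    refine mul_nonpos_of_nonpos_of_nonneg (mul_nonpos_of_nonneg_of_nonpos (by positivity) ?_)
      (Real.exp_pos _).le
    rw [sub_nonpos, fieldAvg, fieldAvg, ← gavg_init (skVec N β (x / √(N : ℝ))) f,
      ← gavg_init (skVec N β (x / √(N : ℝ))) fun τ : Fin 3 → Config N => f (Fin.init τ),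
      ← gavg_mul_left]
    refine gavg_mono _ fun τ => (le_abs_self _).trans ((abs_lap_le_mul f τ).trans ?_)
    rw [abs_of_nonneg (sq_nonneg _)]
    norm_num
  have h := hanti Set.self_mem_Ici hy hy
  simp only [fieldAvg_zero, ne_eq, OfNat.ofNat_ne_zero, not_false_eq_true, zero_pow, mul_zero,
    neg_zero, Real.exp_zero, mul_one] at h
  rw [Real.exp_neg, ← div_eq_mul_inv, div_le_iff₀ (Real.exp_pos _)] at h
  exact h

lemma gavg_q_sq (v : Couple N ⊕ Fin N → Config N → ℝ) (a b : Fin 4) (hab : a ≠ b) :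
    gavg v (fun τ : Fin 4 → Config N => q a b τ ^ 2) =
      gavg v (fun τ : Fin 2 → Config N => q 0 1 τ ^ 2) := by
  rw [← gavg_init v fun τ : Fin 2 → Config N => q 0 1 τ ^ 2,
    ← gavg_init v fun τ : Fin 3 → Config N => q 0 1 (Fin.init τ) ^ 2]
  set e : Equiv.Perm (Fin 4) := (Equiv.swap 1 (Equiv.swap 0 a b)).trans (Equiv.swap 0 a) with he
  have h0 : e 0 = a := by
    rw [he, Equiv.trans_apply, Equiv.swap_apply_of_ne_of_ne zero_ne_one, Equiv.swap_apply_left]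
    intro h
    apply hab
    have := congrArg (Equiv.swap 0 a) h
    simpa using this
  have h1 : e 1 = b := by simp [he]
  refine Eq.trans ?_ (gavg_perm v e _)
  congr 1; ext τ
  simp only [q_eq_overlap, Fin.init, Function.comp_apply]
  change _ = overlap (τ (e 0)) (τ (e 1)) ^ 2
  rw [h0, h1]

/-- Each product of overlaps is at most the half-sum of their squares, and all squares have the same
average: `9/2 + 1/4 + 3/4 + 1/4 + 3/4 + 3/2 = 8`. -/
lemma fieldAvg_lap_q_le (hN : 0 < N) (β y : ℝ) :
    fieldAvg N β (lap (q (0 : Fin 2) 1)) y ≤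
      8 * fieldAvg N β (fun τ : Fin 2 → Config N => q 0 1 τ ^ 2) y := by
  have h := gavg_q_sq (skVec N β (y / √(N : ℝ)))
  have h01 := h 0 1 (by decide)
  have h02 := h 0 2 (by decide)
  have h03 := h 0 3 (by decide)
  have h12 := h 1 2 (by decide)
  have h13 := h 1 3 (by decide)
  have h23 := h 2 3 (by decide)
  have hle : fieldAvg N β (lap (q (0 : Fin 2) 1)) y ≤ gavg (skVec N β (y / √(N : ℝ)))
      (fun τ : Fin 4 → Config N => 9 / 2 * q 0 1 τ ^ 2 + (1 / 4 * q 0 2 τ ^ 2 +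
        (3 / 4 * q 0 3 τ ^ 2 + (1 / 4 * q 1 2 τ ^ 2 + (3 / 4 * q 1 3 τ ^ 2 +
          3 / 2 * q 2 3 τ ^ 2))))) := by
    refine gavg_mono _ fun τ => ?_
    rw [lap_q hN]
    nlinarith [sq_nonneg (q 0 1 τ + q 0 2 τ), sq_nonneg (q 0 1 τ + q 0 3 τ),
      sq_nonneg (q 0 1 τ + q 1 2 τ), sq_nonneg (q 0 1 τ + q 1 3 τ),
      sq_nonneg (q 0 1 τ - q 2 3 τ)]
  rw [gavg_add, gavg_add, gavg_add, gavg_add, gavg_add] at hle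
  simp only [gavg_mul_left, h01, h02, h03, h12, h13, h23] at hle
  unfold fieldAvg at *
  linarith

/-- The average overlap vanishes at `y = 0`. Its derivative in `y ^ 2` is at most `8 * meanSq * exp
(12 * y ^ 2)`, below that of the right-hand side. -/
lemma fieldAvg_q_le (hN : 0 < N) (β : ℝ) {y : ℝ} (hy : 0 ≤ y) :
    fieldAvg N β (q (0 : Fin 2) 1) y ≤ meanSq N β * Real.exp (12 * y ^ 2) := by
  have hd : ∀ y, HasDerivAt (fun y => fieldAvg N β (q (0 : Fin 2) 1) y -
      meanSq N β * Real.exp (12 * y ^ 2)) (2 * y * (fieldAvg N β (lap (q (0 : Fin 2) 1)) y -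
        12 * (meanSq N β * Real.exp (12 * y ^ 2)))) y := by
    intro y
    have h1 : HasDerivAt (fun y : ℝ => 12 * y ^ 2) (24 * y) y := by
      convert! (hasDerivAt_pow 2 y).const_mul 12 using 1
      push_cast; ring
    convert! (hasDerivAt_fieldAvg β _ y).sub (h1.exp.const_mul (meanSq N β)) using 1
    ring
  have hanti : AntitoneOn (fun y => fieldAvg N β (q (0 : Fin 2) 1) y -
      meanSq N β * Real.exp (12 * y ^ 2)) (Set.Ici 0) := by
    refine antitoneOn_of_deriv_nonpos (convex_Ici _)
      (fun x _ => (hd x).continuousAt.continuousWithinAt)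
      (fun x _ => (hd x).differentiableAt.differentiableWithinAt) fun x hx => ?_
    rw [interior_Ici] at hx
    have hx' : 0 < x := hx
    rw [(hd x).deriv]
    have h1 := fieldAvg_lap_q_le hN β x
    have h2 := fieldAvg_sq_le (N := N) β hx'.le
    have h3 := mul_nonneg (meanSq_nonneg (N := N) β) (Real.exp_pos (12 * x ^ 2)).le
    exact mul_nonpos_of_nonneg_of_nonpos (by positivity) (by linarith)
  have h := hanti Set.self_mem_Ici hy hy
  simp only [fieldAvg_zero, gavg_q_zero, ne_eq, OfNat.ofNat_ne_zero, not_false_eq_true, zero_pow,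
    mul_zero, Real.exp_zero, mul_one] at h
  linarith [meanSq_nonneg (N := N) β]

lemma fieldPressure_ge (hN : 0 < N) (β : ℝ) {y : ℝ} (hy : 0 ≤ y) :
    pressure N β + y ^ 2 / 2 - y ^ 2 / 2 * Real.exp (12 * y ^ 2) * meanSq N β ≤
      fieldPressure N β y := by
  set K := meanSq N β * Real.exp (12 * y ^ 2) with hK
  have hd : ∀ x, HasDerivAt (fun x => fieldPressure N β x - (1 - K) / 2 * x ^ 2)
      (x * (K - fieldAvg N β (q (0 : Fin 2) 1) x)) x := by
    intro x
    convert! (hasDerivAt_fieldPressure hN β x).sub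
      ((hasDerivAt_pow 2 x).const_mul ((1 - K) / 2)) using 1
    push_cast; ring
  have hmono : MonotoneOn (fun x => fieldPressure N β x - (1 - K) / 2 * x ^ 2)
      (Set.Icc 0 y) := by
    refine monotoneOn_of_deriv_nonneg (convex_Icc _ _)
      (fun x _ => (hd x).continuousAt.continuousWithinAt)
      (fun x _ => (hd x).differentiableAt.differentiableWithinAt) fun x hx => ?_
    rw [interior_Icc] at hx
    rw [(hd x).deriv]
    refine mul_nonneg hx.1.le (sub_nonneg.2 ((fieldAvg_q_le hN β hx.1.le).trans ?_))
    refine mul_le_mul_of_nonneg_left (Real.exp_le_exp.2 ?_) (meanSq_nonneg β)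
    have := pow_le_pow_left₀ hx.1.le hx.2.le 2
    linarith
  have h := hmono ⟨le_rfl, hy⟩ ⟨hy, le_rfl⟩ hy
  simp only [fieldPressure_zero] at h
  rw [hK] at h
  linarith

end FieldPressure

/-! ### Independent spins in Gaussian fields. -/

section FreeSpins

/-- A single spin in a Gaussian field. -/
lemma fieldPressure_one_le {y : ℝ} (hy : 0 ≤ y) :
    fieldPressure 1 0 y ≤
      Real.log 2 + y ^ 2 / 2 - y ^ 4 / 4 + y ^ 6 / 3 + 840 * y ^ 8 := by
  have hq : ∀ {n : ℕ} (a b : Fin n) (τ : Fin n → Config 1), q a b τ ^ 2 = 1 := by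
    intro n a b τ
    simp only [q, Finset.univ_unique, Finset.sum_singleton, Nat.cast_one, div_one, one_mul]
    rw [mul_pow, sq, sq, spin_mul_self, spin_mul_self, one_mul]
  -- For one spin every squared overlap is `1`, so the general expansion becomes explicit.
  -- Integrating `x * (1 - fieldAvg)` gives the polynomial, with `840 = 6720 / 8`.
  have hG : ∀ x : ℝ, 0 ≤ x → x ^ 2 - 2 * x ^ 4 - 6720 * x ^ 6 ≤
      fieldAvg 1 0 (q (0 : Fin 2) 1) x := by
    intro x hx
    have h := abs_average_expansion_le 1 0 x
    rw [average_eq_fieldAvg, average_zero_eq, average_zero_eq, abs_of_nonneg hx] at h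
    simp only [hq, gavg_const] at h
    have h2 : gavg (skVec 1 0 0) (fun τ : Fin 3 → Config 1 => q 0 1 τ * q 1 2 τ * q 0 2 τ) ≤ 1 :=
      (le_abs_self _).trans (abs_gavg_le _ fun τ => by
        rw [abs_mul, abs_mul]
        exact mul_le_one₀ (mul_le_one₀ (abs_q_le _ _ _) (abs_nonneg _) (abs_q_le _ _ _))
          (abs_nonneg _) (abs_q_le _ _ _))
    have h3 := (abs_le.1 h).1
    have h4 := mul_le_mul_of_nonneg_right h2 (by positivity : 0 ≤ x ^ 4)
    linarith
  have hd : ∀ x, HasDerivAt (fun x => x ^ 2 / 2 - x ^ 4 / 4 + x ^ 6 / 3 + 840 * x ^ 8 -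
      fieldPressure 1 0 x) (x * (fieldAvg 1 0 (q (0 : Fin 2) 1) x -
        (x ^ 2 - 2 * x ^ 4 - 6720 * x ^ 6))) x := by
    intro x
    convert! (((((hasDerivAt_pow 2 x).div_const 2).sub ((hasDerivAt_pow 4 x).div_const 4)).add
      ((hasDerivAt_pow 6 x).div_const 3)).add ((hasDerivAt_pow 8 x).const_mul 840)).sub
      (hasDerivAt_fieldPressure one_pos 0 x) using 1
    push_cast; ring
  have hmono : MonotoneOn (fun x => x ^ 2 / 2 - x ^ 4 / 4 + x ^ 6 / 3 + 840 * x ^ 8 -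
      fieldPressure 1 0 x) (Set.Ici 0) := by
    refine monotoneOn_of_deriv_nonneg (convex_Ici _)
      (fun x _ => (hd x).continuousAt.continuousWithinAt)
      (fun x _ => (hd x).differentiableAt.differentiableWithinAt) fun x hx => ?_
    rw [interior_Ici] at hx
    rw [(hd x).deriv]
    exact mul_nonneg (le_of_lt hx) (sub_nonneg.2 (hG x (le_of_lt hx)))
  have h := hmono Set.self_mem_Ici hy hy
  have h0 : pressure 1 0 = Real.log 2 := by
    have : skVec 1 0 0 = fun _ _ => 0 := by
      ext i σ
      rcases i with p | i <;> simp [skVec]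
    rw [pressure, this, logPart_zero, log_card_config]
    simp
  simp only [fieldPressure_zero, h0] at h
  norm_num at h
  linarith

/-- Independent spins in independent Gaussian fields. -/
lemma logPart_free (N : ℕ) (r : ℝ) :
    logPart (skVec N 0 r) = N * fieldPressure 1 0 r := by
  induction N with
  | zero =>
    have : skVec 0 0 r = fun _ _ => 0 := by
      ext i σ
      rcases i with p | i
      · exact p.1.1.elim0
      · exact i.elim0
    rw [this, logPart_zero]
    simp
  | succ N ih =>
    have h1 := logPart_prod (skVec N 0 r) (skVec 1 0 r)
    rw [← logPart_equiv (Fin.appendEquiv N 1 (α := ℤˣ)).symm] at h1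
    have h2 : fieldPressure 1 0 r = logPart (skVec 1 0 r) := by simp [fieldPressure]
    rw [Nat.cast_succ, add_mul, one_mul, ← ih, h2, ← h1]
    refine logPart_congr_cov _ _ fun σ σ' => ?_
    have hc : ∀ σ σ' : Config (N + 1), cov (fun i t => (Sum.elim
        (fun i (p : Config N × Config 1) => skVec N 0 r i p.1) (fun j p => skVec 1 0 r j p.2)) i
          ((Fin.appendEquiv N 1 (α := ℤˣ)).symm t)) σ σ' = cov (skVec (N + 1) 0 r) σ σ' := by
      intro σ σ'
      simp only [cov, Fintype.sum_sum_type, skVec, Sum.elim_inl, Sum.elim_inr, zero_div, zero_mul,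
        Finset.sum_const_zero, zero_add]
      rw [Fin.sum_univ_add]
      rfl
    rw [← hc, ← hc]

end FreeSpins

/-! ### The mean square overlap below the critical temperature. -/

section LowTemperature

/-- A sequence with increments eventually above `m` grows at rate at least `m`. -/
lemma le_of_increments {u : ℕ → ℝ} {m F : ℝ} (h : ∀ᶠ N in atTop, u N + m ≤ u (N + 1))
    (hF : Tendsto (fun N : ℕ => u N / N) atTop (𝓝 F)) : m ≤ F := by
  obtain ⟨K, hK⟩ := eventually_atTop.1 h
  have h1 : ∀ N ≥ K, u K + (N - K) * m ≤ u N := by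
    intro N hN
    induction N, hN using Nat.le_induction with
    | base => simp
    | succ N hN ih =>
      have := hK N hN
      push_cast
      linarith
  have h2 : Tendsto (fun N : ℕ => (u K - K * m) / N + m) atTop (𝓝 (0 + m)) :=
    (tendsto_const_div_atTop_nhds_zero_nat _).add tendsto_const_nhds
  rw [zero_add] at h2
  refine le_of_tendsto_of_tendsto h2 hF ?_
  filter_upwards [eventually_ge_atTop K, eventually_gt_atTop 0] with N hN hN0
  have hN' : (0 : ℝ) < N := by positivity
  rw [div_add' _ _ _ hN'.ne', div_le_div_iff_of_pos_right hN']
  linarith [h1 N hN]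

/-- The added spin gains about `log 2 + β ^ 2 / 2` through the field at `y = β`. Returning from the
shifted temperature to `β` costs `β ^ 2 / 4 + β ^ 2 / (4 * N)`. -/
lemma pressure_increment_ge {N : ℕ} (hN : 0 < N) {β : ℝ} (hβ : 0 < β) :
    pressure N β + (Real.log 2 + β ^ 2 / 4 - β ^ 2 / (4 * N)
      - β ^ 2 / 2 * Real.exp (12 * β ^ 2) * meanSq N β) ≤ pressure (N + 1) β := by
  have hN' : (0 : ℝ) < N := by positivity
  have h1 := pressure_succ hN β
  have h2 := fieldPressure_ge hN β hβ.le
  rw [fieldPressure] at h2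
  have e : (β * √((N + 1) / N)) ^ 2 = β ^ 2 + β ^ 2 / N := by
    rw [mul_pow, Real.sq_sqrt (by positivity)]
    field_simp
  have h3 := pressure_temperature_le (Nat.succ_pos N) (β := β) (β' := β * √((N + 1) / N))
    (by rw [e]; linarith [div_nonneg (sq_nonneg β) hN'.le])
  rw [e] at h3
  have e2 : ((N + 1 : ℕ) : ℝ) * (β ^ 2 + β ^ 2 / N - β ^ 2) / 4 =
      β ^ 2 / 4 + β ^ 2 / (4 * N) := by
    push_cast
    field_simp
    ring
  rw [Nat.succ_eq_add_one, e2] at h3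
  linarith

/-- Below the critical temperature the pressure is strictly below its annealed value,
uniformly in bounded ranges of temperatures. -/
lemma exists_pressure_gap {β₀ : ℝ} (hβ : 1 < β₀) :
    ∃ d : ℝ, 0 < d ∧ ∀ N : ℕ, 0 < N → ∀ β : ℝ, β₀ ≤ β →
      pressure N β ≤ N * (Real.log 2 + β ^ 2 / 4 - d) := by
  set κ : ℝ := 1 - 1 / β₀ ^ 2 with hκ
  have hb : 1 < β₀ ^ 2 := one_lt_pow₀ hβ two_ne_zero
  have hκ0 : 0 < κ := by
    rw [hκ, sub_pos, div_lt_one (by positivity)]; exact hb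
  have hκ1 : κ ≤ 1 := by
    rw [hκ]; linarith [one_div_nonneg.2 (sq_nonneg β₀)]
  -- With overlap parameter `s / β ^ 2`, Guerra's bound minus the annealed value is at most `-κ * s
  -- ^ 2 / 4 + s ^ 3 / 3 + 840 * s ^ 4`. Since `6728 = 8 * 841`, the last two terms use at most half
  -- of the gain.
  set s : ℝ := κ / 6728 with hs
  have hs0 : 0 < s := by positivity
  have hs1 : s ≤ 1 := by rw [hs]; linarith
  refine ⟨κ * s ^ 2 / 8, by positivity, fun N hN β hββ => ?_⟩
  have hβ0 : 0 < β := by linarith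
  have h1 := pressure_le_field hN β (s / β ^ 2) (√s)
    (by rw [Real.sq_sqrt hs0.le]; field_simp)
  have h2 := fieldPressure_one_le (Real.sqrt_nonneg s)
  rw [logPart_free] at h1
  have e2 : √s ^ 2 = s := Real.sq_sqrt hs0.le
  have e4 : √s ^ 4 = s ^ 2 := by rw [show 4 = 2 * 2 by rfl, pow_mul, e2]
  have e6 : √s ^ 6 = s ^ 3 := by rw [show 6 = 2 * 3 by rfl, pow_mul, e2]
  have e8 : √s ^ 8 = s ^ 4 := by rw [show 8 = 2 * 4 by rfl, pow_mul, e2]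
  rw [e2, e4, e6, e8] at h2
  have hk : 1 / β ^ 2 ≤ 1 - κ := by
    rw [hκ]
    have := one_div_le_one_div_of_le (by positivity) (pow_le_pow_left₀ (by linarith) hββ 2)
    linarith
  have h3 : β ^ 2 / 4 * (1 - s / β ^ 2) ^ 2 = β ^ 2 / 4 - s / 2 + s ^ 2 / 4 * (1 / β ^ 2) := by
    field_simp
    ring
  have h4 : s ^ 2 / 4 * (1 / β ^ 2) ≤ s ^ 2 / 4 * (1 - κ) :=
    mul_le_mul_of_nonneg_left hk (by positivity)
  have h5 : s ^ 3 / 3 + 840 * s ^ 4 ≤ s ^ 2 * (κ / 8) := by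
    have hκs : κ / 8 = 841 * s := by rw [hs]; ring
    rw [hκs]
    have := mul_le_mul_of_nonneg_left hs1 (by positivity : 0 ≤ s ^ 3)
    linarith [pow_pos hs0 3, show s ^ 4 = s ^ 3 * s by ring, show s ^ 2 * (841 * s) = 841 * s ^ 3 by ring]
  rw [h3] at h1
  have hN' : (0 : ℝ) ≤ N := Nat.cast_nonneg N
  rw [← mul_add] at h1
  refine h1.trans (mul_le_mul_of_nonneg_left ?_ hN')
  linarith

/-- Below the critical temperature, the mean square overlap stays away from zero. -/
theorem exists_le_meanSq {β₀ : ℝ} (hβ : 1 < β₀) :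
    ∃ c : ℝ, 0 < c ∧ ∀ᶠ N in atTop, c ≤ meanSq N β₀ := by
  by_contra hcon
  push Not at hcon
  have hfreq : ∀ ε : ℝ, 0 < ε → ∃ᶠ N in atTop, meanSq N β₀ < ε := fun ε hε => by
    simpa using hcon ε hε
  obtain ⟨d, hd, hgap⟩ := exists_pressure_gap hβ
  set K : ℝ := (β₀ + 1) ^ 2 / 2 * Real.exp (12 * (β₀ + 1) ^ 2) with hK
  have hK0 : 0 < K := by positivity
  -- The shift is small enough that the cavity error `K * meanSq`, with `meanSq` of order `h`,
  -- remains below the gap `d`.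
  obtain ⟨h, hh0, hh1, hhK⟩ : ∃ h : ℝ, 0 < h ∧ h ≤ 1 ∧ K * h ≤ d / 4 := by
    refine ⟨min 1 (d / (4 * K)), by positivity, min_le_left _ _, ?_⟩
    refine (mul_le_mul_of_nonneg_left (min_le_right _ _) hK0.le).trans (le_of_eq ?_)
    field_simp
  set β : ℝ := β₀ + h with hβdef
  have hβ0 : 0 < β₀ := by linarith
  have hβpos : 0 < β := by linarith
  obtain ⟨F₀, hF₀⟩ := tendsto_pressure β₀
  obtain ⟨F, hF⟩ := tendsto_pressure β
  -- The tangent at `β₀`, taken at the infinitely many sizes with small `meanSq`, has almost the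
  -- annealed slope. As the pressures converge along all sizes, the bound holds for the limits.
  have hdiff : h * β₀ / 2 ≤ F - F₀ := by
    refine le_of_forall_pos_le_add fun ε hε => ?_
    by_contra hlt
    push Not at hlt
    have hev := (hF.sub hF₀).eventually_lt_const (show F - F₀ < h * β₀ / 2 - ε by linarith)
    obtain ⟨N, hN1, hN2, hN3⟩ :=
      ((hfreq (2 * ε / (h * β₀)) (by positivity)).and_eventually
        (hev.and (eventually_gt_atTop 0))).exists
    have hN' : (0 : ℝ) < N := by positivity
    have ht := pressure_tangent hN3 hβ0 β
    rw [← sub_div, div_lt_iff₀ hN'] at hN2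
    rw [lt_div_iff₀ (by positivity)] at hN1
    have e : (β - β₀) * (N * β₀ / 2 * (1 - meanSq N β₀)) =
        N * (h * β₀ / 2) - N / 2 * (meanSq N β₀ * (h * β₀)) := by
      rw [hβdef]; ring
    rw [e] at ht
    have := mul_le_mul_of_nonneg_left hN1.le (by positivity : (0 : ℝ) ≤ N / 2)
    linarith
  -- The tangent at `β`, read backwards to `β₀`, bounds `meanSq N β` by about `h / β ≤ h`, now for
  -- all large `N`. The cavity increments require this passage from a subsequence to all sizes.
  have hupper : ∀ δ : ℝ, 0 < δ → ∀ᶠ N in atTop, meanSq N β ≤ h + δ := by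
    intro δ hδ
    have hev := (hF.sub hF₀).eventually_const_lt
      (show h * β₀ / 2 - h * β / 2 * δ < F - F₀ by linarith [show 0 < h * β / 2 * δ by positivity])
    filter_upwards [hev, eventually_gt_atTop 0] with N hN1 hN
    have hN' : (0 : ℝ) < N := by positivity
    have ht := pressure_tangent hN hβpos β₀
    rw [← sub_div, lt_div_iff₀ hN'] at hN1
    have e : (β₀ - β) * (N * β / 2 * (1 - meanSq N β)) =
        N * (h * β / 2 * meanSq N β - h * β / 2) := by
      rw [hβdef]; ring
    rw [e] at ht
    have h1 : N * (h / 2 * (β₀ - β * δ)) < N * (h / 2 * (β - β * meanSq N β)) := by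
      linarith
    have h2 := lt_of_mul_lt_mul_left (lt_of_mul_lt_mul_left h1 hN'.le) (by positivity)
    have h3 : β * (meanSq N β) < β * (h + δ) := by
      have : h ≤ β * h := le_mul_of_one_le_left hh0.le (by linarith)
      rw [mul_add]
      linarith
    exact (lt_of_mul_lt_mul_left h3 hβpos.le).le
  have hKβ : β ^ 2 / 2 * Real.exp (12 * β ^ 2) ≤ K := by
    have : β ^ 2 ≤ (β₀ + 1) ^ 2 := pow_le_pow_left₀ hβpos.le (by linarith) 2
    rw [hK]
    gcongr
  have hlow : Real.log 2 + β ^ 2 / 4 - 3 * d / 4 ≤ F := by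
    refine le_of_increments ?_ hF
    have hsmall : ∀ᶠ N : ℕ in atTop, β ^ 2 / 4 / (N : ℝ) < d / 4 :=
      (tendsto_const_div_atTop_nhds_zero_nat _).eventually_lt_const (by positivity)
    filter_upwards [hupper (d / (4 * K)) (by positivity), hsmall, eventually_gt_atTop 0]
      with N h1 h2 hN
    refine le_trans ?_ (pressure_increment_ge hN hβpos)
    have h3 : β ^ 2 / 2 * Real.exp (12 * β ^ 2) * meanSq N β ≤ K * (h + d / (4 * K)) :=
      mul_le_mul hKβ h1 (meanSq_nonneg β) hK0.le
    have h4 : K * (h + d / (4 * K)) ≤ d / 2 := by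
      have : K * (h + d / (4 * K)) = K * h + d / 4 := by field_simp
      linarith
    rw [div_div] at h2
    linarith
  have hup : F ≤ Real.log 2 + β ^ 2 / 4 - d := by
    refine le_of_tendsto hF ?_
    filter_upwards [eventually_gt_atTop 0] with N hN
    have hN' : (0 : ℝ) < N := by positivity
    rw [div_le_iff₀ hN', mul_comm]
    exact hgap N hN β (by linarith)
  linarith

end LowTemperature

/-! ### Empirical averages over replicas and Gaussian exponential moments. -/

section Sampling

variable {S I J : Type*} [Fintype S] [Fintype I] [Fintype J] [Nonempty S]

lemma rep_one (E : S → ℝ) (c : S → ℝ) :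
    rep E (fun τ : Fin 1 → S => c (τ 0)) = ∑ s, c s * gw E s := by
  simpa using rep_prod E (fun _ : Fin 1 => c)

lemma rep_sq_sum {E d : S → ℝ} (h : ∑ s, d s * gw E s = 0) (n : ℕ) :
    rep E (fun τ : Fin n → S => (∑ a, d (τ a)) ^ 2) = n * ∑ s, d s ^ 2 * gw E s := by
  induction n with
  | zero =>
    have := rep_const (n := 0) E 0
    simpa using this
  | succ n ih =>
    rw [rep_succ]
    have e : ∀ (τ : Fin n → S), ∑ s, (∑ a, d (Fin.snoc (α := fun _ => S) τ s a)) ^ 2 * gw E s =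
        (∑ a, d (τ a)) ^ 2 + ∑ s, d s ^ 2 * gw E s := by
      intro τ
      have e1 : ∀ s, (∑ a, d (Fin.snoc (α := fun _ => S) τ s a)) ^ 2 * gw E s =
          (∑ a, d (τ a)) ^ 2 * gw E s + 2 * (∑ a, d (τ a)) * (d s * gw E s)
            + d s ^ 2 * gw E s := by
        intro s
        rw [Fin.sum_univ_castSucc]
        simp only [Fin.snoc_castSucc, Fin.snoc_last]
        ring
      simp only [e1]
      rw [Finset.sum_add_distrib, Finset.sum_add_distrib, ← Finset.mul_sum, ← Finset.mul_sum, h,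
        sum_gw]
      ring
    simp only [e]
    rw [rep_add, ih, rep_const]
    push_cast
    ring

lemma abs_log_sub_log_le {x y : ℝ} (hx : 1 ≤ x) (hy : 1 ≤ y) :
    |Real.log x - Real.log y| ≤ |x - y| := by
  have key : ∀ x y : ℝ, 1 ≤ x → 1 ≤ y → Real.log x - Real.log y ≤ |x - y| := by
    intro x y hx hy
    rw [← Real.log_div (by positivity) (by positivity)]
    refine (Real.log_le_sub_one_of_pos (by positivity)).trans ?_
    rw [div_sub_one (by positivity)]
    refine (div_le_div_of_nonneg_right (le_abs_self _) (by positivity)).trans ?_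
    exact div_le_self (abs_nonneg _) hy
  rw [abs_le]
  have h1 := key x y hx hy
  have h2 := key y x hy hx
  rw [abs_sub_comm] at h2
  exact ⟨by linarith, h1⟩

/-- The logarithm of a Gibbs average is well approximated by the logarithm of the empirical
average over `n` replicas. -/
lemma abs_log_sub_rep_log_le (E c : S → ℝ) (hc : ∀ s, 1 ≤ c s) {n : ℕ} (hn : 0 < n) :
    |Real.log (∑ s, c s * gw E s) -
      rep E (fun τ : Fin n → S => Real.log ((1 / n) * ∑ a, c (τ a)))| ≤
      (1 + ∑ s, c s ^ 2 * gw E s) / √(n : ℝ) := by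
  have hn' : (0 : ℝ) < n := by positivity
  set m := ∑ s, c s * gw E s with hm
  have hm1 : 1 ≤ m := by
    rw [← sum_gw E]
    exact Finset.sum_le_sum fun s _ => le_mul_of_one_le_left (gw_nonneg E s) (hc s)
  have hV : ∀ τ : Fin n → S, 1 ≤ (1 / n) * ∑ a, c (τ a) := by
    intro τ
    have := Finset.card_nsmul_le_sum Finset.univ (fun a => c (τ a)) 1 fun a _ => hc (τ a)
    simp only [Finset.card_univ, Fintype.card_fin, nsmul_eq_mul, mul_one] at this
    rw [one_div, le_inv_mul_iff₀ hn', mul_one]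
    exact this
  have hd : ∑ s, (c s - m) * gw E s = 0 := by
    simp only [sub_mul, Finset.sum_sub_distrib, ← Finset.mul_sum, sum_gw, mul_one, ← hm, sub_self]
  have hvar := rep_sq_sum hd n
  have hs2 : ∑ s, (c s - m) ^ 2 * gw E s ≤ ∑ s, c s ^ 2 * gw E s := by
    have : ∀ s, (c s - m) ^ 2 * gw E s =
        c s ^ 2 * gw E s - 2 * m * (c s * gw E s) + m ^ 2 * gw E s := fun s => by ring
    simp only [this]
    rw [Finset.sum_add_distrib, Finset.sum_sub_distrib, ← Finset.mul_sum, ← Finset.mul_sum, ← hm,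
      sum_gw]
    nlinarith
  rw [← rep_const (n := n) E (Real.log m), ← rep_sub]
  have hsq : 0 < √(n : ℝ) := Real.sqrt_pos.2 hn'
  have hss : √(n : ℝ) * √(n : ℝ) = n := Real.mul_self_sqrt hn'.le
  -- The logarithm is `1`-Lipschitz on `[1, ∞)`, and `x ^ 2 * |D| ≤ x + x ^ 3 * D ^ 2` for `x = 1 /
  -- √n` bounds the deviation by a quantity whose average is just a variance.
  have hpt : ∀ τ : Fin n → S, |Real.log m - Real.log ((1 / n) * ∑ a, c (τ a))| ≤
      1 / √(n : ℝ) + (1 / √(n : ℝ)) ^ 3 * (∑ a, (c (τ a) - m)) ^ 2 := by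
    intro τ
    refine (abs_log_sub_log_le hm1 (hV τ)).trans ?_
    have e : m - (1 / n) * ∑ a, c (τ a) = -((1 / √(n : ℝ)) ^ 2 * ∑ a, (c (τ a) - m)) := by
      rw [Finset.sum_sub_distrib]
      simp only [Finset.sum_const, Finset.card_univ, Fintype.card_fin, nsmul_eq_mul, div_pow,
        Real.sq_sqrt hn'.le]
      field_simp
      ring
    rw [e, abs_neg, abs_mul, abs_of_pos (by positivity)]
    set D := ∑ a, (c (τ a) - m)
    set x := 1 / √(n : ℝ)
    have hx : 0 < x := by positivity
    rw [← sq_abs D]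
    nlinarith [sq_nonneg (1 - x * |D|), abs_nonneg D, mul_nonneg hx.le (sq_nonneg (1 - x * |D|)),
      mul_nonneg hx.le (abs_nonneg D)]
  have habs : ∀ f : (Fin n → S) → ℝ, |rep E f| ≤ rep E fun τ => |f τ| := by
    intro f
    rw [abs_le]
    constructor
    · have := rep_mono E (f := fun τ => -1 * |f τ|) (g := f) fun τ => by
        linarith [neg_abs_le (f τ)]
      rw [rep_mul_left] at this
      linarith
    · exact rep_mono E fun τ => le_abs_self _
  refine (habs _).trans ((rep_mono E hpt).trans ?_)
  rw [rep_add, rep_const, rep_mul_left, hvar]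
  have e2 : (1 / √(n : ℝ)) ^ 3 * (n * ∑ s, (c s - m) ^ 2 * gw E s) =
      (∑ s, (c s - m) ^ 2 * gw E s) / √(n : ℝ) := by
    have : (n : ℝ) = √(n : ℝ) ^ 2 := by rw [sq, hss]
    generalize √(n : ℝ) = x at *
    rw [this]; field_simp
  rw [e2, add_div]
  gcongr

lemma integral_exp_gaussian (c : ℝ) :
    ∫ x, Real.exp (c * x) ∂gaussianReal 0 1 = Real.exp (c ^ 2 / 2) := by
  have := congrFun (mgf_id_gaussianReal (μ := 0) (v := 1)) c
  simpa [mgf] using this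

lemma exp_linear_eq_prod (c : I → ℝ) (ω : I → ℝ) :
    Real.exp (∑ i, ω i * c i) = ∏ i, Real.exp (c i * ω i) := by
  rw [Real.exp_sum]; simp [mul_comm]

lemma integrable_exp_linear (c : I → ℝ) :
    Integrable (fun ω : I → ℝ => Real.exp (∑ i, ω i * c i)) (stdGauss I) := by
  simp only [exp_linear_eq_prod]
  exact Integrable.fintype_prod fun i => integrable_exp_mul_gaussianReal (c i)

lemma integral_exp_linear (c : I → ℝ) :
    ∫ ω, Real.exp (∑ i, ω i * c i) ∂stdGauss I = Real.exp ((∑ i, c i ^ 2) / 2) := by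
  simp only [exp_linear_eq_prod]
  rw [stdGauss, integral_fintype_prod_eq_prod (𝕜 := ℝ) (fun (i : I) (x : ℝ) => Real.exp (c i * x))]
  simp only [integral_exp_gaussian]
  rw [← Real.exp_sum, Finset.sum_div]

lemma integral_sum_mul (w : (I → ℝ) → ℝ) (F : (J → ℝ) → ℝ) :
    ∫ ω : I ⊕ J → ℝ, w (ω ∘ Sum.inl) * F (ω ∘ Sum.inr) ∂stdGauss (I ⊕ J) =
      (∫ ω, w ω ∂stdGauss I) * ∫ ω, F ω ∂stdGauss J := by
  rw [← integral_prod_mul]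
  exact (measurePreserving_sumPiEquivProdPi
    fun _ : I ⊕ J => gaussianReal 0 1).integral_comp'
      fun p : (I → ℝ) × (J → ℝ) => w p.1 * F p.2

end Sampling

/-! ### The field pressure as a function of overlaps. -/

section EmpiricalPressure

variable {N : ℕ}

/-- Coefficients of the exponents `±z_a` attached to the replicas. -/
def replicaVec {N n : ℕ} (y : ℝ) (τ : Fin n → Config N) (i : Fin N) (p : Fin n × ℤˣ) : ℝ :=
  y / √(N : ℝ) * (((p.2 : ℤ) : ℝ) * spin (τ p.1) i)

/-- The expected logarithm of the empirical average of `cosh z`. -/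
def empPressure {N n : ℕ} (y : ℝ) (τ : Fin n → Config N) : ℝ := logPart (replicaVec y τ)

lemma cov_replicaVec (hN : 0 < N) {n : ℕ} (y : ℝ) (τ : Fin n → Config N) (p p' : Fin n × ℤˣ) :
    cov (replicaVec y τ) p p' =
      y ^ 2 * (((p.2 : ℤ) : ℝ) * ((p'.2 : ℤ) : ℝ)) * overlap (τ p.1) (τ p'.1) := by
  have hN' : (0 : ℝ) < N := by positivity
  have : ∀ i, replicaVec y τ i p * replicaVec y τ i p' = y ^ 2 / N *
      (((p.2 : ℤ) : ℝ) * ((p'.2 : ℤ) : ℝ)) * (spin (τ p.1) i * spin (τ p'.1) i) := by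
    intro i
    have h : y ^ 2 / N = (y / √(N : ℝ)) ^ 2 := by rw [div_pow, Real.sq_sqrt hN'.le]
    rw [h, replicaVec, replicaVec]
    ring
  simp only [cov, this, ← Finset.mul_sum, sum_spin_mul]
  field_simp

lemma unit_mul_self (u : ℤˣ) : ((u : ℤ) : ℝ) * ((u : ℤ) : ℝ) = 1 := by
  rcases Int.units_eq_one_or u with h | h <;> simp [h]

lemma abs_unit (u : ℤˣ) : |((u : ℤ) : ℝ)| = 1 := by
  rcases Int.units_eq_one_or u with h | h <;> simp [h]

/-- The covariance of the exponents depends on the replicas only through their overlaps, so Gaussian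
comparison applies even between systems of different sizes. -/
lemma empPressure_le {M n : ℕ} [NeZero n] (hN : 0 < N) (hM : 0 < M) (y : ℝ)
    (τ : Fin n → Config N) (τ' : Fin n → Config M) {δ : ℝ}
    (h : ∀ a b, |q a b τ - q a b τ'| ≤ δ) :
    empPressure y τ ≤ empPressure y τ' + y ^ 2 * δ / 2 := by
  refine logPart_le_of_cov _ _ _ fun p p' => ?_
  rw [cov_replicaVec hN, cov_replicaVec hN, cov_replicaVec hM, cov_replicaVec hM, unit_mul_self,
    overlap_self hN, overlap_self hM]
  have h1 := h p.1 p'.1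
  simp only [q_eq_overlap] at h1
  set o := overlap (τ p.1) (τ p'.1)
  set o' := overlap (τ' p.1) (τ' p'.1)
  have h2 : |((p.2 : ℤ) : ℝ) * ((p'.2 : ℤ) : ℝ) * (o' - o)| ≤ δ := by
    rw [abs_mul, abs_mul, abs_unit, abs_unit, one_mul, one_mul, abs_sub_comm]
    exact h1
  have h3 := mul_le_mul_of_nonneg_left ((le_abs_self _).trans h2) (sq_nonneg y)
  linarith

/-- The exponent of the external field. -/
def fieldEnergy (y : ℝ) (h : Fin N → ℝ) (σ : Config N) : ℝ :=
  ∑ i, h i * (y / √(N : ℝ) * spin σ i)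

lemma fieldEnergy_neg (y : ℝ) (h : Fin N → ℝ) (σ : Config N) :
    fieldEnergy y h (-σ) = -fieldEnergy y h σ := by
  simp [fieldEnergy, spin_neg]

lemma energy_skVec_add (β y : ℝ) (ω : Couple N ⊕ Fin N → ℝ) (σ : Config N) :
    energy (skVec N β (y / √(N : ℝ))) ω σ =
      energy (skVec N β 0) ω σ + fieldEnergy y (ω ∘ Sum.inr) σ := by
  simp [energy, skVec, Fintype.sum_sum_type, fieldEnergy]

/-- The zero-field Gibbs measure is even, so only the `cosh` part of the exponential of the field
energy survives. -/
lemma log_partition_field (β y : ℝ) (ω : Couple N ⊕ Fin N → ℝ) :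
    Real.log (∑ σ, Real.exp (energy (skVec N β (y / √(N : ℝ))) ω σ)) =
      Real.log (∑ σ, Real.exp (energy (skVec N β 0) ω σ)) +
        Real.log (∑ σ, Real.cosh (fieldEnergy y (ω ∘ Sum.inr) σ) *
          gw (energy (skVec N β 0) ω) σ) := by
  have h1 : ∑ σ, Real.cosh (fieldEnergy y (ω ∘ Sum.inr) σ) * gw (energy (skVec N β 0) ω) σ =
      (∑ σ, Real.exp (energy (skVec N β (y / √(N : ℝ))) ω σ)) /
        ∑ σ, Real.exp (energy (skVec N β 0) ω σ) := by
    have h2 := sum_odd_mul_gw β ω (φ := fun σ => Real.sinh (fieldEnergy y (ω ∘ Sum.inr) σ))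
      fun σ => by simp only [fieldEnergy_neg, Real.sinh_neg]
    refine (add_zero _).symm.trans ?_
    nth_rewrite 2 [← h2]
    rw [← Finset.sum_add_distrib, Finset.sum_div]
    refine Finset.sum_congr rfl fun σ _ => ?_
    rw [← add_mul, Real.cosh_add_sinh, energy_skVec_add, Real.exp_add, gw]
    ring
  rw [h1, Real.log_div (sum_exp_pos _).ne' (sum_exp_pos _).ne']
  ring

/-- Writing `2 cosh` as a sum over signs turns the empirical average into a partition function on `2
* n` states, to which Gaussian comparison applies. -/
lemma log_empirical {n : ℕ} (hn : 0 < n) (y : ℝ) (h : Fin N → ℝ) (τ : Fin n → Config N) :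
    Real.log ((1 / n) * ∑ a, Real.cosh (fieldEnergy y h (τ a))) =
      Real.log (∑ p, Real.exp (energy (replicaVec y τ) h p)) - Real.log (2 * n) := by
  have hn' : (0 : ℝ) < n := by positivity
  have e1 : ∀ a (u : ℤˣ), energy (replicaVec y τ) h (a, u) =
      ((u : ℤ) : ℝ) * fieldEnergy y h (τ a) := by
    intro a u
    simp only [energy, replicaVec, fieldEnergy, Finset.mul_sum]
    exact Finset.sum_congr rfl fun i _ => by ring
  have e : ∑ p, Real.exp (energy (replicaVec y τ) h p) =
      2 * n * ((1 / n) * ∑ a, Real.cosh (fieldEnergy y h (τ a))) := by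
    rw [Fintype.sum_prod_type, ← mul_assoc, mul_one_div, mul_div_assoc, div_self hn'.ne', mul_one,
      Finset.mul_sum]
    refine Finset.sum_congr rfl fun a _ => ?_
    have : (Finset.univ : Finset ℤˣ) = {1, -1} := rfl
    simp only [e1, this]
    rw [Finset.sum_pair (by decide), Real.cosh_eq]
    simp
    ring
  have : Nonempty (Fin n) := ⟨⟨0, hn⟩⟩
  have hpos : 0 < (1 / (n : ℝ)) * ∑ a, Real.cosh (fieldEnergy y h (τ a)) :=
    mul_pos (by positivity) (Finset.sum_pos (fun a _ => Real.cosh_pos _) Finset.univ_nonempty)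
  rw [e, Real.log_mul (x := 2 * n) (by positivity) hpos.ne', add_sub_cancel_left]

/-- The zero-field weights involve only the couplings, which are independent of the fields. The
fields can therefore be integrated first, with the replicas frozen. -/
lemma integral_rep_field (β : ℝ) {n : ℕ} (F : (Fin n → Config N) → (Fin N → ℝ) → ℝ)
    (hF : ∀ τ, Integrable (F τ) (stdGauss (Fin N))) :
    Integrable (fun ω : Couple N ⊕ Fin N → ℝ =>
      rep (energy (skVec N β 0) ω) fun τ => F τ (ω ∘ Sum.inr)) (stdGauss (Couple N ⊕ Fin N)) ∧
    ∫ ω : Couple N ⊕ Fin N → ℝ, rep (energy (skVec N β 0) ω) (fun τ => F τ (ω ∘ Sum.inr))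
      ∂stdGauss (Couple N ⊕ Fin N) = gavg (skVec N β 0) fun τ => ∫ h, F τ h ∂stdGauss (Fin N) := by
  set w : (Fin n → Config N) → (Couple N → ℝ) → ℝ := fun τ J =>
    ∏ a, gw (energy (skVec N β 0) (Sum.elim J 0)) (τ a) with hw
  have hE : ∀ ω : Couple N ⊕ Fin N → ℝ, energy (skVec N β 0) ω =
      energy (skVec N β 0) (Sum.elim (ω ∘ Sum.inl) 0) := by
    intro ω
    ext σ
    simp [energy, skVec, Fintype.sum_sum_type]
  have hrep : ∀ (ω : Couple N ⊕ Fin N → ℝ) (f : (Fin n → Config N) → ℝ),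
      rep (energy (skVec N β 0) ω) f = ∑ τ, w τ (ω ∘ Sum.inl) * f τ := by
    intro ω f
    rw [hE, rep]
    exact Finset.sum_congr rfl fun τ _ => mul_comm _ _
  have hwc : ∀ τ, Continuous (w τ) := by
    intro τ
    have h1 : Continuous fun J : Couple N → ℝ => (Sum.elim J 0 : Couple N ⊕ Fin N → ℝ) := by
      refine continuous_pi fun i => ?_
      rcases i with i | i
      · exact continuous_apply i
      · exact continuous_const
    refine continuous_finsetProd _ fun a _ => ?_
    unfold gw
    have h2 := (continuous_energy (skVec N β 0)).comp h1
    have h3 : ∀ σ, Continuous fun J : Couple N → ℝ => energy (skVec N β 0) (Sum.elim J 0) σ :=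
      fun σ => (continuous_apply σ).comp h2
    exact Continuous.div (Real.continuous_exp.comp (h3 _))
      (continuous_finsetSum _ fun σ _ => Real.continuous_exp.comp (h3 σ))
      fun J => (sum_exp_pos _).ne'
  have hwb : ∀ τ J, |w τ J| ≤ 1 := by
    intro τ J
    rw [hw, Finset.abs_prod]
    exact Finset.prod_le_one (fun _ _ => abs_nonneg _) fun a _ => by
      rw [abs_of_nonneg (gw_nonneg _ _)]; exact gw_le_one _ _
  have m1 := measurePreserving_inl (I := Couple N) (J := Fin N)
  have m2 := measurePreserving_inr (I := Couple N) (J := Fin N)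
  have hint : ∀ τ, Integrable (fun ω : Couple N ⊕ Fin N → ℝ =>
      w τ (ω ∘ Sum.inl) * F τ (ω ∘ Sum.inr)) (stdGauss (Couple N ⊕ Fin N)) := by
    intro τ
    have h2 := (m2.integrable_comp (hF τ).1).2 (hF τ)
    exact h2.bdd_mul (c := 1) (((hwc τ).aestronglyMeasurable (μ := stdGauss (Couple N))).comp_measurePreserving m1)
      (ae_of_all _ fun ω => hwb τ _)
  have hw1 : ∀ τ, Integrable (fun ω : Couple N ⊕ Fin N → ℝ =>
      w τ (ω ∘ Sum.inl) * ∫ h, F τ h ∂stdGauss (Fin N)) (stdGauss (Couple N ⊕ Fin N)) := by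
    intro τ
    refine Integrable.mul_const ?_ _
    exact (m1.integrable_comp (hwc τ).aestronglyMeasurable).2
      (integrable_bounded_continuous (hwc τ) (hwb τ))
  simp only [gavg, hrep]
  refine ⟨integrable_finsetSum _ fun τ _ => hint τ, ?_⟩
  rw [integral_finsetSum _ fun τ _ => hint τ, integral_finsetSum _ fun τ _ => hw1 τ]
  refine Finset.sum_congr rfl fun τ _ => ?_
  rw [integral_sum_mul]
  have := integral_sum_mul (I := Couple N) (J := Fin N) (w τ)
    fun _ => ∫ h, F τ h ∂stdGauss (Fin N)
  rw [this]
  simp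

/-- The field energy of a configuration is Gaussian of variance `y ^ 2` when `N > 0`, so the
sampling error has a bound free of `N`. -/
lemma integrable_cosh_sq (y : ℝ) (σ : Config N) :
    Integrable (fun h => Real.cosh (fieldEnergy y h σ) ^ 2) (stdGauss (Fin N)) ∧
      ∫ h, Real.cosh (fieldEnergy y h σ) ^ 2 ∂stdGauss (Fin N) ≤ Real.exp (2 * y ^ 2) := by
  have e : ∀ h, Real.cosh (fieldEnergy y h σ) ^ 2 =
      1 / 4 * Real.exp (∑ i, h i * (2 * (y / √(N : ℝ) * spin σ i))) +
      1 / 4 * Real.exp (∑ i, h i * (-2 * (y / √(N : ℝ) * spin σ i))) + 1 / 2 := by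
    intro h
    have h1 : ∑ i, h i * (2 * (y / √(N : ℝ) * spin σ i)) =
        fieldEnergy y h σ + fieldEnergy y h σ := by
      rw [← two_mul, fieldEnergy, Finset.mul_sum]
      exact Finset.sum_congr rfl fun i _ => by ring
    have h2 : ∑ i, h i * (-2 * (y / √(N : ℝ) * spin σ i)) =
        -fieldEnergy y h σ + -fieldEnergy y h σ := by
      rw [← two_mul, mul_neg, ← neg_mul, fieldEnergy, Finset.mul_sum]
      exact Finset.sum_congr rfl fun i _ => by ring
    rw [h1, h2, Real.exp_add, Real.exp_add, Real.cosh_eq]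
    have : Real.exp (fieldEnergy y h σ) * Real.exp (-fieldEnergy y h σ) = 1 := by
      rw [← Real.exp_add]; simp
    linear_combination (1 / 2) * this
  have hv : ∀ c : ℝ, c ^ 2 = 4 → (∑ i, (c * (y / √(N : ℝ) * spin σ i)) ^ 2) / 2 ≤ 2 * y ^ 2 := by
    intro c hc
    have : ∀ i, (c * (y / √(N : ℝ) * spin σ i)) ^ 2 = 4 * y ^ 2 / N := by
      intro i
      rw [mul_pow, mul_pow, div_pow, Real.sq_sqrt (Nat.cast_nonneg N), sq (spin σ i),
        spin_mul_self, hc]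
      ring
    simp only [this, Finset.sum_const, Finset.card_univ, Fintype.card_fin, nsmul_eq_mul]
    rcases Nat.eq_zero_or_pos N with rfl | hN
    · simp; positivity
    · have : (N : ℝ) ≠ 0 := by positivity
      field_simp
      linarith
  have i1 := (integrable_exp_linear fun i : Fin N => 2 * (y / √(N : ℝ) * spin σ i)).const_mul
    (1 / 4)
  have i2 := (integrable_exp_linear fun i : Fin N => -2 * (y / √(N : ℝ) * spin σ i)).const_mul
    (1 / 4)
  simp only [e]
  refine ⟨(i1.add i2).add (integrable_const _), ?_⟩
  have hadd := (integral_add (i1.add i2) (integrable_const (1 / 2 : ℝ))).trans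
    (congrArg (· + ∫ _, (1 / 2 : ℝ) ∂stdGauss (Fin N)) (integral_add i1 i2))
  rw [integral_const_mul, integral_const_mul, integral_exp_linear, integral_exp_linear] at hadd
  refine hadd.le.trans ?_
  have h1 := Real.exp_le_exp.2 (hv 2 (by norm_num))
  have h2 := Real.exp_le_exp.2 (hv (-2) (by norm_num))
  have h3 : 1 ≤ Real.exp (2 * y ^ 2) := Real.one_le_exp (by positivity)
  simp only [integral_const, probReal_univ, smul_eq_mul, one_mul]
  linarith

/-- The field pressure is approximated, uniformly in the size of the system, by the average of
a function of the overlaps of `n` replicas. -/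
lemma abs_fieldPressure_sub_empPressure_le (N : ℕ) (β y : ℝ) {n : ℕ} (hn : 0 < n) :
    |fieldPressure N β y - pressure N β -
      (gavg (skVec N β 0) (fun τ : Fin n → Config N => empPressure y τ) - Real.log (2 * n))| ≤
      (1 + Real.exp (2 * y ^ 2)) / √(n : ℝ) := by
  have : Nonempty (Fin n) := ⟨⟨0, hn⟩⟩
  set E : (Couple N ⊕ Fin N → ℝ) → Config N → ℝ := energy (skVec N β 0) with hE
  set c : (Couple N ⊕ Fin N → ℝ) → Config N → ℝ := fun ω σ =>
    Real.cosh (fieldEnergy y (ω ∘ Sum.inr) σ) with hc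
  set P := stdGauss (Couple N ⊕ Fin N) with hP
  have hiF := integrable_log_part (skVec N β (y / √(N : ℝ)))
  have hi0 := integrable_log_part (skVec N β 0)
  have h1 : fieldPressure N β y - pressure N β = ∫ ω, Real.log (∑ σ, c ω σ * gw (E ω) σ) ∂P := by
    rw [fieldPressure, pressure, logPart, logPart, ← integral_sub hiF hi0]
    congr 1; ext ω
    rw [log_partition_field]
    ring
  have hi1 : Integrable (fun ω => Real.log (∑ σ, c ω σ * gw (E ω) σ)) P := by
    refine (hiF.sub hi0).congr (ae_of_all _ fun ω => ?_)
    simp only [Pi.sub_apply]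
    rw [log_partition_field]
    ring
  have hiE : ∀ τ : Fin n → Config N, Integrable (fun h =>
      Real.log (∑ p, Real.exp (energy (replicaVec y τ) h p)) - Real.log (2 * n))
      (stdGauss (Fin N)) := fun τ =>
    (integrable_log_part (replicaVec y τ)).sub (integrable_const _)
  obtain ⟨hi2, h2⟩ := integral_rep_field β (fun (τ : Fin n → Config N) h =>
    Real.log (∑ p, Real.exp (energy (replicaVec y τ) h p)) - Real.log (2 * n)) hiE
  have h3 : gavg (skVec N β 0) (fun τ : Fin n → Config N => empPressure y τ) - Real.log (2 * n) =
      ∫ ω, rep (E ω) (fun τ : Fin n → Config N => Real.log ((1 / n) * ∑ a, c ω (τ a))) ∂P := by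
    simp only [hc, log_empirical hn]
    rw [h2]
    have h4 := gavg_const (n := n) (skVec N β 0) (Real.log (2 * n))
    nth_rewrite 1 [← h4]
    rw [← gavg_sub]
    congr 1; ext τ
    rw [integral_sub (integrable_log_part _) (integrable_const _)]
    simp [empPressure, logPart]
  have hi3 : Integrable (fun ω => rep (E ω)
      (fun τ : Fin n → Config N => Real.log ((1 / n) * ∑ a, c ω (τ a)))) P := by
    simp only [hc, log_empirical hn]
    exact hi2
  obtain ⟨hi4, h4⟩ := integral_rep_field β (fun (τ : Fin 1 → Config N) h =>
    Real.cosh (fieldEnergy y h (τ 0)) ^ 2) fun τ => (integrable_cosh_sq y (τ 0)).1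
  rw [h1, h3, ← integral_sub hi1 hi3]
  refine (abs_integral_le_integral_abs).trans ?_
  have hb : ∀ ω, |Real.log (∑ σ, c ω σ * gw (E ω) σ) -
      rep (E ω) (fun τ : Fin n → Config N => Real.log ((1 / n) * ∑ a, c ω (τ a)))| ≤
      (1 + rep (E ω) (fun τ : Fin 1 → Config N => c ω (τ 0) ^ 2)) / √(n : ℝ) := by
    intro ω
    rw [rep_one (E ω) fun σ => c ω σ ^ 2]
    exact abs_log_sub_rep_log_le (E ω) (c ω) (fun σ => Real.one_le_cosh _) hn
  refine (integral_mono (hi1.sub hi3).abs (((integrable_const 1).add hi4).div_const _) hb).trans ?_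
  rw [integral_div]
  refine div_le_div_of_nonneg_right ?_ (Real.sqrt_nonneg _)
  refine (integral_add (integrable_const 1) hi4).le.trans ?_
  rw [h4]
  simp only [integral_const, probReal_univ, smul_eq_mul, one_mul]
  have := gavg_mono (skVec N β 0) (f := fun τ : Fin 1 → Config N =>
    ∫ h, Real.cosh (fieldEnergy y h (τ 0)) ^ 2 ∂stdGauss (Fin N))
    (g := fun _ => Real.exp (2 * y ^ 2)) fun τ => (integrable_cosh_sq y (τ 0)).2
  rw [gavg_const] at this
  linarith

end EmpiricalPressure

/-- The estimate at distance zero makes `P` a function of `Q`; this function is Lipschitz on the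
range of `Q` and extends to all of `E`. -/
lemma exists_lipschitz_factor {X E : Type*} [PseudoMetricSpace E] (Q : X → E) (P : X → ℝ)
    (K : NNReal) (h : ∀ x x', |P x - P x'| ≤ K * dist (Q x) (Q x')) :
    ∃ Ψ : E → ℝ, LipschitzWith K Ψ ∧ ∀ x, Ψ (Q x) = P x := by
  classical
  set f : E → ℝ := fun e => if h : ∃ x, Q x = e then P h.choose else 0 with hf
  have hfQ : ∀ x, f (Q x) = P x := by
    intro x
    have hx : ∃ x', Q x' = Q x := ⟨x, rfl⟩
    simp only [hf, dif_pos hx]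
    have := h hx.choose x
    rw [hx.choose_spec, dist_self, mul_zero] at this
    exact sub_eq_zero.1 (abs_eq_zero.1 (le_antisymm this (abs_nonneg _)))
  have hL : LipschitzOnWith K f (Set.range Q) := by
    refine LipschitzOnWith.of_dist_le_mul ?_
    rintro _ ⟨x, rfl⟩ _ ⟨x', rfl⟩
    rw [hfQ, hfQ, Real.dist_eq]
    exact h x x'
  obtain ⟨Ψ, hΨ, hE⟩ := hL.extend_real
  exact ⟨Ψ, hΨ, fun x => by rw [← hE ⟨x, rfl⟩, hfQ]⟩

lemma cauchySeq_of_approx {u : ℕ → ℝ}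
    (h : ∀ ε > 0, ∃ w : ℕ → ℝ, CauchySeq w ∧ ∀ j, |u j - w j| ≤ ε) : CauchySeq u := by
  rw [Metric.cauchySeq_iff']
  intro ε hε
  obtain ⟨w, hw, hd⟩ := h (ε / 4) (by positivity)
  obtain ⟨K, hK⟩ := Metric.cauchySeq_iff'.1 hw (ε / 4) (by positivity)
  refine ⟨K, fun j hj => ?_⟩
  have h1 := hK j hj
  rw [Real.dist_eq] at h1 ⊢
  have h2 := abs_le.1 (hd j)
  have h3 := abs_le.1 (hd K)
  have h4 := abs_lt.1 h1
  rw [abs_lt]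
  constructor <;> linarith

/-! ### Convergence along sequences with a thermodynamic limit. -/

section Overlaps

variable {N : ℕ}

/-- The overlaps of `n` replicas, as a point of a cube. -/
def overlapPoint {N n : ℕ} (τ : Fin n → Config N) (p : Fin n × Fin n) : Set.Icc (-1 : ℝ) 1 :=
  ⟨q p.1 p.2 τ, abs_le.1 (abs_q_le _ _ _)⟩

/-- By Stone-Weierstrass, polynomials in the overlaps are uniformly dense on the cube, and averaging
is a contraction for the uniform norm. -/
lemma cauchySeq_continuous {β : ℝ} {φ : ℕ → ℕ} (h : HasThermodynamicLimit β φ) {n : ℕ}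
    (f : C(Fin n × Fin n → Set.Icc (-1 : ℝ) 1, ℝ)) :
    CauchySeq fun j => gavg (skVec (φ j) β 0)
      fun τ : Fin n → Config (φ j) => f (overlapPoint τ) := by
  set coord : Fin n × Fin n → C(Fin n × Fin n → Set.Icc (-1 : ℝ) 1, ℝ) := fun p =>
    ⟨fun x => (x p : ℝ), by fun_prop⟩ with hcoord
  set A := Algebra.adjoin ℝ (Set.range coord) with hA
  have hsep : A.SeparatesPoints := by
    intro x x' hne
    obtain ⟨p, hp⟩ := Function.ne_iff.1 hne
    refine ⟨coord p, ⟨coord p, Algebra.subset_adjoin ⟨p, rfl⟩, rfl⟩, ?_⟩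
    intro heq
    exact hp (Subtype.ext heq)
  have htop := ContinuousMap.subalgebra_topologicalClosure_eq_top_of_separatesPoints A hsep
  have hmono : ∀ g ∈ Submonoid.closure (Set.range coord), ∃ k : Fin n → Fin n → ℕ,
      ∀ x, g x = ∏ a, ∏ b, (x (a, b) : ℝ) ^ k a b := by
    intro g hg
    induction hg using Submonoid.closure_induction with
    | mem g hg =>
      obtain ⟨p, rfl⟩ := hg
      refine ⟨fun a b => if (a, b) = p then 1 else 0, fun x => ?_⟩
      rw [← Fintype.prod_prod_type' (f := fun a b => (x (a, b) : ℝ) ^ (if (a, b) = p then 1 else 0)),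
        Finset.prod_eq_single p]
      · simp [hcoord]
      · intro p' _ hp'
        simp [hp']
      · simp
    | one => exact ⟨fun _ _ => 0, fun x => by simp⟩
    | mul g g' _ _ ih ih' =>
      obtain ⟨k, hk⟩ := ih
      obtain ⟨k', hk'⟩ := ih'
      refine ⟨fun a b => k a b + k' a b, fun x => ?_⟩
      rw [ContinuousMap.mul_apply, hk, hk']
      simp only [pow_add, Finset.prod_mul_distrib]
  have hAlg : ∀ g ∈ A, CauchySeq fun j => gavg (skVec (φ j) β 0)
      fun τ : Fin n → Config (φ j) => g (overlapPoint τ) := by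
    intro g hg
    rw [← Subalgebra.mem_toSubmodule, hA, Algebra.adjoin_eq_span] at hg
    induction hg using Submodule.span_induction with
    | mem g hg =>
      obtain ⟨k, hk⟩ := hmono g hg
      obtain ⟨l, hl⟩ := h n k
      simp only [hk]
      simp only [average_zero_eq] at hl
      exact hl.cauchySeq
    | zero => simpa [gavg_const] using cauchySeq_const (0 : ℝ)
    | add g g' _ _ ih ih' =>
      simp only [ContinuousMap.add_apply, gavg_add]
      exact ih.add ih'
    | smul c g _ ih =>
      simp only [ContinuousMap.smul_apply, smul_eq_mul, gavg_mul_left]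
      exact (uniformContinuous_const_smul c).comp_cauchySeq ih
  refine cauchySeq_of_approx fun ε hε => ?_
  have hf : f ∈ A.topologicalClosure := by rw [htop]; trivial
  rw [← SetLike.mem_coe, Subalgebra.topologicalClosure_coe, Metric.mem_closure_iff] at hf
  obtain ⟨g, hg, hd⟩ := hf ε hε
  refine ⟨_, hAlg g hg, fun j => ?_⟩
  rw [← gavg_sub]
  refine abs_gavg_le _ fun τ => ?_
  rw [← Real.dist_eq]
  exact (ContinuousMap.dist_apply_le_dist _).trans hd.le

lemma cauchySeq_empPressure {β : ℝ} {φ : ℕ → ℕ} (hφ : ∀ j, 0 < φ j)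
    (h : HasThermodynamicLimit β φ) {n : ℕ} (hn : 0 < n) (y : ℝ) :
    CauchySeq fun j => gavg (skVec (φ j) β 0)
      fun τ : Fin n → Config (φ j) => empPressure y τ := by
  have : NeZero n := ⟨hn.ne'⟩
  -- The domain gathers all positive sizes at once, so that one function `Ψ` serves the whole
  -- sequence.
  obtain ⟨Ψ, hΨ, hE⟩ := exists_lipschitz_factor
    (X := Σ N : ℕ, Fin n → Config (N + 1)) (fun x => overlapPoint x.2)
    (fun x => empPressure y x.2) (y ^ 2 / 2).toNNReal fun x x' => by
      have key : ∀ x x' : Σ N : ℕ, Fin n → Config (N + 1), empPressure y x.2 - empPressure y x'.2 ≤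
          y ^ 2 / 2 * dist (overlapPoint x.2) (overlapPoint x'.2) := by
        intro x x'
        have := empPressure_le (Nat.succ_pos x.1) (Nat.succ_pos x'.1) y x.2 x'.2
          (δ := dist (overlapPoint x.2) (overlapPoint x'.2)) fun a b =>
            dist_le_pi_dist (overlapPoint x.2) (overlapPoint x'.2) (a, b)
        linarith
      rw [Real.coe_toNNReal _ (by positivity), abs_le]
      refine ⟨?_, key x x'⟩
      have := key x' x
      rw [dist_comm] at this
      linarith
  have h1 := cauchySeq_continuous h ⟨Ψ, hΨ.continuous⟩
  convert h1 using 2 with j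
  congr 1; ext τ
  obtain ⟨m, hm⟩ := Nat.exists_eq_succ_of_ne_zero (hφ j).ne'
  have : ∀ (N : ℕ) (τ : Fin n → Config N), N = m + 1 → empPressure y τ = Ψ (overlapPoint τ) := by
    rintro N τ rfl
    exact (hE ⟨m, τ⟩).symm
  exact this _ τ hm

lemma cauchySeq_fieldPressure {β : ℝ} {φ : ℕ → ℕ} (hφ : ∀ j, 0 < φ j)
    (h : HasThermodynamicLimit β φ) (y : ℝ) :
    CauchySeq fun j => fieldPressure (φ j) β y - pressure (φ j) β := by
  refine cauchySeq_of_approx fun ε hε => ?_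
  obtain ⟨n, hn, hne⟩ : ∃ n : ℕ, 0 < n ∧ (1 + Real.exp (2 * y ^ 2)) / √(n : ℝ) < ε := by
    have ht : Tendsto (fun n : ℕ => (1 + Real.exp (2 * y ^ 2)) / √(n : ℝ)) atTop (𝓝 0) :=
      tendsto_const_nhds.div_atTop (Real.tendsto_sqrt_atTop.comp tendsto_natCast_atTop_atTop)
    exact ((eventually_gt_atTop 0).and (ht.eventually_lt_const hε)).exists
  refine ⟨fun j => gavg (skVec (φ j) β 0)
      (fun τ : Fin n → Config (φ j) => empPressure y τ) - Real.log (2 * n), ?_, fun j =>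
        (abs_fieldPressure_sub_empPressure_le (φ j) β y hn).trans hne.le⟩
  simp only [sub_eq_add_neg]
  exact (cauchySeq_empPressure hφ h hn y).add_const

/-- On `[y, y + δ]` the second derivative of the field pressure is at most `1 + 1 + 2 * (y + 1) ^ 2
* 12`, whatever `N`; the mean value inequality is applied twice. -/
lemma abs_fieldPressure_sub_le (hN : 0 < N) (β : ℝ) {y δ : ℝ} (hy : 0 ≤ y) (hδ : 0 ≤ δ)
    (hδ1 : δ ≤ 1) :
    |fieldPressure N β (y + δ) - fieldPressure N β y -
      δ * (y * (1 - fieldAvg N β (q (0 : Fin 2) 1) y))| ≤ (2 + 24 * (y + 1) ^ 2) * δ * δ := by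
  set G := fieldAvg N β (q (0 : Fin 2) 1) with hG
  set G₁ := fieldAvg N β (lap (q (0 : Fin 2) 1)) with hG₁
  set C := 2 + 24 * (y + 1) ^ 2 with hC
  have hGb : ∀ x, |G x| ≤ 1 := fun x => abs_gavg_le _ fun τ => abs_q_le _ _ _
  have hG₁b : ∀ x, |G₁ x| ≤ 12 := fun x => abs_gavg_le _ fun τ =>
    (abs_lap_le (fun τ => abs_q_le _ _ _) τ).trans (by norm_num)
  have hr : ∀ x, HasDerivAt (fun x => x * (1 - G x)) (1 - G x - 2 * x ^ 2 * G₁ x) x := by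
    intro x
    convert! (hasDerivAt_id' x).mul ((hasDerivAt_fieldAvg β (q (0 : Fin 2) 1) x).const_sub 1)
      using 1
    ring
  have hrb : ∀ x ∈ Set.Icc y (y + δ), ‖1 - G x - 2 * x ^ 2 * G₁ x‖ ≤ C := by
    intro x hx
    have hx0 : 0 ≤ x := hy.trans hx.1
    have hx2 : x ^ 2 ≤ (y + 1) ^ 2 := pow_le_pow_left₀ hx0 (by linarith [hx.2]) 2
    have h1 : |2 * x ^ 2 * G₁ x| ≤ 24 * (y + 1) ^ 2 := by
      rw [abs_mul, abs_of_nonneg (by positivity)]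
      nlinarith [hG₁b x, sq_nonneg x]
    have h2 := abs_le.1 (hGb x)
    have h3 := abs_le.1 h1
    rw [Real.norm_eq_abs, abs_le]
    constructor <;> linarith
  have hyI : y ∈ Set.Icc y (y + δ) := ⟨le_rfl, by linarith⟩
  have hlip : ∀ x ∈ Set.Icc y (y + δ), ‖x * (1 - G x) - y * (1 - G y)‖ ≤ C * δ := by
    intro x hx
    refine ((convex_Icc y (y + δ)).norm_image_sub_le_of_norm_hasDerivWithin_le
      (fun x _ => (hr x).hasDerivWithinAt) hrb hyI hx).trans ?_
    refine mul_le_mul_of_nonneg_left ?_ (by positivity)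
    rw [Real.norm_eq_abs, abs_of_nonneg (by linarith [hx.1])]
    linarith [hx.2]
  have hF : ∀ x, HasDerivAt (fun x => fieldPressure N β x - x * (y * (1 - G y)))
      (x * (1 - G x) - y * (1 - G y)) x := by
    intro x
    convert! (hasDerivAt_fieldPressure hN β x).sub
      ((hasDerivAt_id' x).mul_const (y * (1 - G y))) using 1
    ring
  have h1 := (convex_Icc y (y + δ)).norm_image_sub_le_of_norm_hasDerivWithin_le
    (fun x _ => (hF x).hasDerivWithinAt) hlip hyI (⟨by linarith, le_rfl⟩ : y + δ ∈ Set.Icc y (y + δ))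
  rw [Real.norm_eq_abs, Real.norm_eq_abs, add_sub_cancel_left, abs_of_nonneg hδ] at h1
  convert h1 using 2
  ring

/-- Difference quotients of the field pressure converge and approximate its derivative uniformly in
the size. Dividing by `y` to recover the overlap requires `y ≠ 0`. -/
lemma cauchySeq_fieldAvg {β : ℝ} {φ : ℕ → ℕ} (hφ : ∀ j, 0 < φ j)
    (h : HasThermodynamicLimit β φ) {y : ℝ} (hy : 0 < y) :
    CauchySeq fun j => fieldAvg (φ j) β (q (0 : Fin 2) 1) y := by
  refine cauchySeq_of_approx fun ε hε => ?_
  set C := 2 + 24 * (y + 1) ^ 2 with hC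
  have hC0 : 0 < C := by positivity
  set δ := min 1 (y * ε / C) with hδ
  have hδ0 : 0 < δ := by positivity
  have hδC : C * δ ≤ y * ε := by
    rw [mul_comm, ← le_div_iff₀ hC0]; exact min_le_right _ _
  set u : ℕ → ℝ := fun j => (fieldPressure (φ j) β (y + δ) - pressure (φ j) β) -
    (fieldPressure (φ j) β y - pressure (φ j) β) with hu
  have hcu : CauchySeq u := by
    obtain ⟨l, hl⟩ := cauchySeq_tendsto_of_complete (cauchySeq_fieldPressure hφ h (y + δ))
    obtain ⟨l', hl'⟩ := cauchySeq_tendsto_of_complete (cauchySeq_fieldPressure hφ h y)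
    exact (hl.sub hl').cauchySeq
  obtain ⟨l, hl⟩ := cauchySeq_tendsto_of_complete hcu
  refine ⟨fun j => 1 - u j / (δ * y), ((hl.div_const (δ * y)).const_sub 1).cauchySeq,
    fun j => ?_⟩
  have h1 := abs_fieldPressure_sub_le (hφ j) β hy.le hδ0.le (min_le_left _ _)
  set G := fieldAvg (φ j) β (q (0 : Fin 2) 1) y
  have e : G - (1 - u j / (δ * y)) = (fieldPressure (φ j) β (y + δ) - fieldPressure (φ j) β y -
      δ * (y * (1 - G))) / (δ * y) := by
    rw [hu]
    field_simp
    ring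
  change |G - (1 - u j / (δ * y))| ≤ ε
  rw [e, abs_div, abs_of_pos (by positivity : 0 < δ * y), div_le_iff₀ (by positivity)]
  refine h1.trans ?_
  have := mul_le_mul_of_nonneg_right hδC hδ0.le
  linarith

end Overlaps

/-! ### Positivity for small fields and vanishing at fixed size. -/

section Conclusion

/-- Below the critical temperature, a small field of variance `y² / N` produces an average
overlap that stays away from zero. -/
lemma exists_fieldAvg_pos {β : ℝ} (hβ : 1 < β) :
    ∃ y₀ : ℝ, 0 < y₀ ∧ ∀ y : ℝ, y ≠ 0 → |y| < y₀ →
      ∃ c : ℝ, 0 < c ∧ ∀ᶠ N : ℕ in atTop, c ≤ average N β (y ^ 2 / (N : ℝ)) (q (0 : Fin 2) 1) := by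
  obtain ⟨c, hc0, hc⟩ := exists_le_meanSq hβ
  -- For `|y| < 1` the triangle term and the remainder total at most `(2 + 6720) * y ^ 4`. The
  -- threshold `c / (2 * 6722)` keeps this below half of `c * y ^ 2`.
  refine ⟨min 1 (c / 13444), by positivity, fun y hy hyy => ?_⟩
  have hy1 : |y| < 1 := hyy.trans_le (min_le_left _ _)
  have hyc : |y| < c / 13444 := hyy.trans_le (min_le_right _ _)
  have hpos : 0 < |y| := abs_pos.2 hy
  have hsq : y ^ 2 = |y| ^ 2 := (sq_abs y).symm
  have hy2 : y ^ 2 < c / 13444 := by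
    rw [hsq]
    nlinarith
  have hy21 : y ^ 2 < 1 := by rw [hsq]; nlinarith
  have hy20 : 0 < y ^ 2 := by positivity
  refine ⟨c / 2 * y ^ 2, by positivity, ?_⟩
  filter_upwards [hc] with N hN
  have h := (abs_le.1 (abs_average_expansion_le N β y)).1
  rw [average_zero_eq, average_zero_eq] at h
  have h2 : gavg (skVec N β 0) (fun τ : Fin 3 → Config N => q 0 1 τ * q 1 2 τ * q 0 2 τ) ≤ 1 :=
    (le_abs_self _).trans (abs_gavg_le _ fun τ => by
      rw [abs_mul, abs_mul]
      exact mul_le_one₀ (mul_le_one₀ (abs_q_le _ _ _) (abs_nonneg _) (abs_q_le _ _ _))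
        (abs_nonneg _) (abs_q_le _ _ _))
  have h3 := mul_le_mul_of_nonneg_right h2 (by positivity : 0 ≤ y ^ 4)
  have h4 : c * y ^ 2 ≤ gavg (skVec N β 0) (fun τ : Fin 2 → Config N => q 0 1 τ ^ 2) * y ^ 2 :=
    mul_le_mul_of_nonneg_right hN hy20.le
  have h6 : y ^ 6 ≤ y ^ 4 := by
    rw [show y ^ 6 = y ^ 4 * y ^ 2 by ring]
    exact mul_le_of_le_one_right (by positivity) hy21.le
  have h5 : 6722 * y ^ 4 ≤ c / 2 * y ^ 2 := by
    rw [show 6722 * y ^ 4 = (6722 * y ^ 2) * y ^ 2 by ring]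
    exact mul_le_mul_of_nonneg_right (by linarith) hy20.le
  linarith

lemma tendsto_average_field_zero (N : ℕ) (β : ℝ) :
    Tendsto (fun x : ℝ => average N β x (q (0 : Fin 2) 1)) (𝓝[>] 0) (𝓝 0) := by
  rcases Nat.eq_zero_or_pos N with rfl | hN
  · have e : (q (0 : Fin 2) 1 : (Fin 2 → Config 0) → ℝ) = fun _ => 0 := by
      ext τ; exact q_eq_zero _ _ _
    simp only [average_eq_gavg, e, gavg_const]
    exact tendsto_const_nhds
  have hN' : (0 : ℝ) < N := by positivity
  have hc : Continuous (fieldAvg N β (q (0 : Fin 2) 1)) :=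
    continuous_iff_continuousAt.2 fun y => (hasDerivAt_fieldAvg β _ y).continuousAt
  have h1 : Tendsto (fun x : ℝ => fieldAvg N β (q (0 : Fin 2) 1) √(N * x)) (𝓝 0) (𝓝 0) := by
    have h2 : Continuous fun x : ℝ => fieldAvg N β (q (0 : Fin 2) 1) √(N * x) :=
      hc.comp (by fun_prop)
    have := h2.tendsto 0
    simpa [fieldAvg_zero, gavg_q_zero] using this
  refine (h1.mono_left nhdsWithin_le_nhds).congr' ?_
  filter_upwards [self_mem_nhdsWithin] with x hx
  have hx' : (0 : ℝ) ≤ N * x := mul_nonneg hN'.le (le_of_lt hx)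
  have := average_eq_fieldAvg β √(N * x) (q (0 : Fin 2) 1 : (Fin 2 → Config N) → ℝ)
  rw [Real.sq_sqrt hx', mul_div_cancel_left₀ _ hN'.ne', abs_of_nonneg (Real.sqrt_nonneg _)] at this
  exact this.symm

end Conclusion

end SK

end

theorem theorem2 (β : ℝ) (hβ : SK.criticalBeta < β) :
    -- positivity in the limit `N → ∞` with `x = y² / N`, for small nonzero `y`
    (∃ y₀ : ℝ, 0 < y₀ ∧ ∀ y : ℝ, y ≠ 0 → |y| < y₀ →
      0 < liminf (fun N : ℕ => SK.average N β (y ^ 2 / (N : ℝ)) (SK.q (0 : Fin 2) 1)) atTop ∧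
      ∀ φ : ℕ → ℕ, StrictMono φ → SK.HasThermodynamicLimit β φ →
        ∃ L : ℝ, 0 < L ∧
          Tendsto (fun j : ℕ =>
            SK.average (φ j) β (y ^ 2 / (φ j : ℝ)) (SK.q (0 : Fin 2) 1)) atTop (𝓝 L)) ∧
    -- without external field, and as `x → 0⁺` at fixed size, the average overlap vanishes
    (∀ N : ℕ, SK.average N β 0 (SK.q (0 : Fin 2) 1) = 0 ∧
      Tendsto (fun x : ℝ => SK.average N β x (SK.q (0 : Fin 2) 1)) (𝓝[>] 0) (𝓝 0)) ∧
    -- the expansion in `y`, with a remainder that is uniform in the size of the system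
    (∃ C : ℝ, ∀ (N : ℕ) (y : ℝ),
      |SK.average N β (y ^ 2 / (N : ℝ)) (SK.q (0 : Fin 2) 1) -
        (SK.average N β 0 (fun τ : Fin 2 → SK.Config N => SK.q 0 1 τ ^ 2) * y ^ 2 -
          2 * SK.average N β 0
            (fun τ : Fin 3 → SK.Config N => SK.q 0 1 τ * SK.q 1 2 τ * SK.q 0 2 τ) * y ^ 4)|
        ≤ C * y ^ 6) := by
  have hβ1 : 1 < β := hβ
  obtain ⟨y₀, hy₀, hpos⟩ := SK.exists_fieldAvg_pos hβ1
  refine ⟨⟨y₀, hy₀, fun y hy hyy => ?_⟩, fun N => ⟨?_, SK.tendsto_average_field_zero N β⟩,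
    6720, fun N y => SK.abs_average_expansion_le N β y⟩
  · obtain ⟨c, hc0, hc⟩ := hpos y hy hyy
    refine ⟨hc0.trans_le (le_liminf_of_le ?_ hc), fun φ hφ hlim => ?_⟩
    · refine Filter.IsCoboundedUnder.of_frequently_le (a := 1) (Frequently.of_forall fun N => ?_)
      rw [SK.average_eq_gavg]
      exact (le_abs_self _).trans (SK.abs_gavg_le _ fun τ => SK.abs_q_le _ _ _)
    -- The first size may be `0`; dropping it makes all sizes positive.
    · have hshift : SK.HasThermodynamicLimit β fun j => φ (j + 1) := fun n k => by
        obtain ⟨l, hl⟩ := hlim n k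
        exact ⟨l, hl.comp (tendsto_add_atTop_nat 1)⟩
      obtain ⟨L, hL⟩ := cauchySeq_tendsto_of_complete (SK.cauchySeq_fieldAvg
        (fun j => (Nat.zero_le _).trans_lt (hφ (Nat.lt_succ_self j))) hshift (abs_pos.2 hy))
      simp only [← SK.average_eq_fieldAvg] at hL
      refine ⟨L, hc0.trans_le (ge_of_tendsto hL ?_), (tendsto_add_atTop_iff_nat 1).1 hL⟩
      exact (hφ.tendsto_atTop.comp (tendsto_add_atTop_nat 1)).eventually hc
  · rw [SK.average_zero_eq, SK.gavg_q_zero]
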